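/- Let $\lambda$ be the security parameter and let $\mathsf{SDE}=(\mathsf{Setup},\mathsf{KG},\mathsf{Enc},\mathsf{Dec})$ be a (public-key) single-decryptor encryption scheme with message space $\{0,1\}^{\ell}$, where $\ell=\ell(\lambda)$ is computable in polynomial time: its algorithms are quantum polynomial time (QPT), $(\mathsf{pk},\mathsf{msk})\leftarrow\mathsf{Setup}(1^\lambda)$ and $\mathsf{ct}\leftarrow\mathsf{Enc}(\mathsf{pk},m)$ are classical, $\mathsf{sk}\leftarrow\mathsf{KG}(\mathsf{msk})$ is a quantum state, and there is a negligible function $\mathsf{negl}$ such that for every message $m$, $\mathsf{Dec}(\mathsf{sk},\mathsf{ct})=m$ with probability at least $1-\mathsf{negl}(\lambda)$. Assume that $\mathsf{SDE}$ is collusion-resistant identical-challenge search anti-piracy secure: for every inverse polynomial $\gamma$ and every QPT adversary $\mathcal A$, the probability that $\mathcal A$ wins the following game is at most $2^{-\ell}+\gamma(\lambda)+\mathsf{negl}(\lambda)$. The challenger samples $(\mathsf{pk},\mathsf{msk})\leftarrow\mathsf{Setup}(1^\lambda)$ and sends $(1^\lambda,\mathsf{pk})$; $\mathcal A$ answers with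 $1^q$ for a $q$ of its choice and receives $q$ independently generated keys $\mathsf{sk}_i\leftarrow\mathsf{KG}(\mathsf{msk})$; $\mathcal A$ outputs $q+1$ (possibly entangled) quantum decryptors, i.e. a state on registers $R_1,\dots,R_{q+1}$ and, for each $i$, a description of an efficient quantum procedure to be run on $R_i$ and a ciphertext; the challenger samples $m\leftarrow\{0,1\}^\ell$ uniformly and $\mathsf{ct}\leftarrow\mathsf{Enc}(\mathsf{pk},m)$ and runs every decryptor on the same $\mathsf{ct}$; $\mathcal A$ wins if all $q+1$ of them output $m$. Define an unclonable encryption scheme $\mathsf{UE}$ with message space $\{0,1\}^\ell$ as follows. - $\mathsf{UE.KG}(1^\lambda)$: sample $(\mathsf{pk},\mathsf{msk})\leftarrow\mathsf{Setup}(1^\lambda)$, $s\leftarrow\{0,1\}^\ell$ uniformly, and $\mathsf{ct}\leftarrow\mathsf{Enc}(\mathsf{pk},s)$; output the encryption key $\mathsf{ek}=(\mathsf{msk},s)$ and the decryption key $\mathsf{dk}=\mathsf{ct}$. - $\mathsf{UE.Enc}(\mathsf{ek},m)$: sample $\mathsf{sk}\leftarrow\mathsf{KG}(\mathsf{msk})$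 and output the ciphertext $(\mathsf{sk},m\oplus s)$. - $\mathsf{UE.Dec}(\mathsf{dk},(\mathsf{sk},\mu))$: compute $s'\leftarrow\mathsf{Dec}(\mathsf{sk},\mathsf{dk})$ and output $\mu\oplus s'$. Then $\mathsf{UE}$ is an unclonable encryption scheme (its algorithms are QPT, and decryption of every message is correct except with negligible probability), and it is multi-challenge search secure: every QPT adversary $(\mathcal A_0,\mathcal A_1,\mathcal A_2,\dots)$ wins the following game with probability at most $2^{-\ell}+\mathsf{negl}(\lambda)$. The challenger samples $(\mathsf{ek},\mathsf{dk})\leftarrow\mathsf{UE.KG}(1^\lambda)$; $\mathcal A_0$, given $1^\lambda$, answers with $1^q$ for a $q$ of its choice; the challenger samples one $m\leftarrow\{0,1\}^\ell$ uniformly and sends $q$ independently generated ciphertexts $\mathsf{UE.Enc}(\mathsf{ek},m)$; $\mathcal A_0$ prepares a state on registers $R_1,\dots,R_{q+1}$; for each $i\in\{1,\dots,q+1\}$, $\mathcal A_i$ receives $R_i$ and $\mathsf{dk}$, without communication with the others, and outputs $m_i'$; the adversary wins if $m_i'=m$ for all $i\in\{1,\dots,q+1\}$. -/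

import Mathlib

open scoped Polynomial

noncomputable section

namespace Unclonable

/-! # A laboratory of qubits

All qubits of an experiment are named by natural numbers. A computational basis state is the finite
set of the qubits that are in state `|1⟩`, so every qubit that has not been used yet is in state
`|0⟩`. Measurement outcomes are tracked as separate branches, each of which carries its
*unnormalised* state vector: the squared norm of that vector is the probability of the branch. -/

/-- A (possibly unnormalised) pure state of all the qubits. -/
abbrev Amp : Type := Finset ℕ →₀ ℂ

/-- The Hadamard gate on qubit `i`. -/
def hadamard (i : ℕ) : Amp →ₗ[ℂ] Amp :=
  Finsupp.linearCombination ℂ fun S =>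
    ((1 / Real.sqrt 2 : ℝ) : ℂ) •
      (Finsupp.single (S.erase i) 1 + Finsupp.single (insert i S) (if i ∈ S then -1 else 1))

/-- The `T` gate `diag(1, e^{iπ/4})` on qubit `i`. -/
def tGate (i : ℕ) : Amp →ₗ[ℂ] Amp :=
  Finsupp.linearCombination ℂ fun S =>
    Finsupp.single S (if i ∈ S then Complex.exp (Complex.I * Real.pi / 4) else 1)

/-- The controlled-not gate with control `c` and target `t` (the identity if `c = t`). -/
def cnotGate (c t : ℕ) : Amp →ₗ[ℂ] Amp :=
  Finsupp.linearCombination ℂ fun S =>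
    Finsupp.single (if c ∈ S ∧ c ≠ t then symmDiff S {t} else S) 1

/-- Projection of qubit `i` onto `|b⟩`, after which the (collapsed) qubit is reset to `|0⟩`. -/
def collapse (i : ℕ) (b : Bool) : Amp →ₗ[ℂ] Amp :=
  Finsupp.linearCombination ℂ fun S =>
    if decide (i ∈ S) = b then Finsupp.single (S.erase i) 1 else 0

/-- The state of a laboratory: the joint state of all qubits, and the name of the next fresh
qubit. -/
structure Lab where
  amp : Amp
  next : ℕ

/-- The laboratory in which no qubit has been used. -/
def Lab.vacuum : Lab := ⟨Finsupp.single ∅ 1, 0⟩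

/-- The squared norm of the state vector, i.e. the probability of the branch. -/
def Lab.weight (L : Lab) : ℝ := ∑ S ∈ L.amp.support, ‖L.amp S‖ ^ 2

/-- Multiply the probability of the branch by `p`. -/
def Lab.scale (p : ℝ) (L : Lab) : Lab := ⟨((Real.sqrt p : ℝ) : ℂ) • L.amp, L.next⟩

/-- A quantum process with classical result in `α` (which may contain names of qubits): from a state
of the laboratory it produces the list of the possible branches. -/
def QComp (α : Type) : Type := Lab → List (α × Lab)

instance : Monad QComp where
  pure a := fun L => [(a, L)]
  bind p f := fun L => (p L).flatMap fun r => f r.1 r.2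

/-- The probability that the process, started in the vacuum, returns `true`. -/
def QComp.prob (p : QComp Bool) : ℝ :=
  ((p Lab.vacuum).map fun r => if r.1 then r.2.weight else 0).sum

/-- Run a process with purely classical input and output in a separate laboratory, which is thrown
away afterwards; only the random classical result is kept. -/
def QComp.isolated {α : Type} (p : QComp α) : QComp α := fun L =>
  (p Lab.vacuum).map fun r => (r.1, L.scale r.2.weight)

/-- A fair coin. -/
def QComp.coin : QComp Bool := fun L => [(false, L.scale (1 / 2)), (true, L.scale (1 / 2))]

/-- A uniformly random string of `k` bits. -/
def QComp.uniformBits : ℕ → QComp (List Bool)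
  | 0 => pure []
  | k + 1 => do
    let b ← QComp.coin
    let w ← QComp.uniformBits k
    return b :: w

/-! # Quantum programs with classical control, and their step count -/

/-- Names of registers: `main i` are a program's own registers (and its interface), `sub j r` is the
register `r` of its `j`-th subroutine. A program is a finite object and uses finitely many of them.
The same names are used for classical and for quantum registers, which are separate. -/
inductive Reg : Type
  | main (i : ℕ) : Reg
  | sub (j : ℕ) (r : Reg) : Reg
  deriving DecidableEq

/-- The memory of one party: each classical register holds a bit string (a stack, the head of the
list being the top), and each quantum register holds a stack of qubits. -/
structure Mem where
  cl : Reg → List Bool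
  qu : Reg → List ℕ

/-- Overwrite a classical register. -/
def Mem.setC (m : Mem) (x : Reg) (w : List Bool) : Mem := ⟨Function.update m.cl x w, m.qu⟩

/-- Overwrite a quantum register. -/
def Mem.setQ (m : Mem) (r : Reg) (l : List ℕ) : Mem := ⟨m.cl, Function.update m.qu r l⟩

/-- The memory with the strings `cs` in the classical registers `main 0, main 1, …`, the qubits `qs`
in the quantum registers `main 0, main 1, …`, and nothing else. -/
def Mem.load (cs : List (List Bool)) (qs : List (List ℕ)) : Mem where
  cl
    | .main i => cs.getD i []
    | .sub _ _ => []
  qu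
    | .main i => qs.getD i []
    | .sub _ _ => []

/-- All registers have length at most `n`. -/
def Mem.Bounded (m : Mem) (n : ℕ) : Prop :=
  ∀ x, (m.cl x).length ≤ n ∧ (m.qu x).length ≤ n

/-- Quantum programs with classical control. `loop x c` repeats `c` as often as the length that the
classical register `x` has when the loop is entered, `qloop` does the same for a quantum register.
All loops are bounded, so that all programs halt; the programs of polynomial step count (see
`PolyTime`) compute everything that is computable in quantum polynomial time, because an unbounded
loop can be run against a clock. -/
inductive Cmd : Type
  | skip : Cmd
  | push (b : Bool) (x : Reg) : Cmd
  | pop (x : Reg) : Cmd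
  | clear (x : Reg) : Cmd
  /-- `y := x ++ y` -/
  | prepend (x y : Reg) : Cmd
  /-- move the first `k` bits of `x` to `y`, where `k` is the length of `u` -/
  | split (u x y : Reg) : Cmd
  /-- `y := x ⊕ y` -/
  | xor (x y : Reg) : Cmd
  | seq (c d : Cmd) : Cmd
  /-- branch on the top bit of `x`: `true`, `false`, or `x` is empty -/
  | branch (x : Reg) (c d e : Cmd) : Cmd
  | loop (x : Reg) (c : Cmd) : Cmd
  | qloop (r : Reg) (c : Cmd) : Cmd
  /-- push a fresh qubit in state `|0⟩` -/
  | qnew (r : Reg) : Cmd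
  /-- Hadamard gate on the top qubit of `r` -/
  | had (r : Reg) : Cmd
  /-- `T` gate on the top qubit of `r` -/
  | tee (r : Reg) : Cmd
  /-- controlled-not, the top qubit of `r` controlling that of `s` -/
  | cnot (r s : Reg) : Cmd
  /-- move the top qubit of `r` to the top of `s` -/
  | qmove (r s : Reg) : Cmd
  /-- move all qubits of `r` on top of `s` -/
  | qappend (r s : Reg) : Cmd
  /-- remove the top qubit of `r`, measure it, and push the outcome on `x` -/
  | meas (r x : Reg) : Cmd

/-- Bitwise exclusive or with `y`; the result has the length of `y` (as if `x` were padded with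
zeros or cut). -/
def xorBits : List Bool → List Bool → List Bool
  | _, [] => []
  | [], y => y
  | a :: x, b :: y => (Bool.xor a b) :: xorBits x y

/-- Apply a linear map to the state of the laboratory. -/
def QComp.gate (g : Amp →ₗ[ℂ] Amp) : QComp Unit := fun L => [((), ⟨g L.amp, L.next⟩)]

/-- Allocate a fresh qubit. -/
def QComp.fresh : QComp ℕ := fun L => [(L.next, ⟨L.amp, L.next + 1⟩)]

/-- Measure the qubit `i` in the computational basis. -/
def QComp.measure (i : ℕ) : QComp Bool := fun L =>
  [(false, ⟨collapse i false L.amp, L.next⟩), (true, ⟨collapse i true L.amp, L.next⟩)]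

/-- Repeat `f` for `k` rounds, adding up the steps and one more for each test of the counter. -/
def iterate (f : Mem → QComp (Mem × ℕ)) : ℕ → Mem → QComp (Mem × ℕ)
  | 0, m => pure (m, 1)
  | k + 1, m => do
    let (m₁, t₁) ← f m
    let (m₂, t₂) ← iterate f k m₁
    return (m₂, t₁ + t₂ + 1)

/-- Execute a program; the result is the final memory and the number of steps. String instructions
are charged the length of the strings they handle, all other instructions one step. Instructions on
a qubit that is not there do nothing. -/
def Cmd.exec : Cmd → Mem → QComp (Mem × ℕ)
  | .skip, m => pure (m, 1)
  | .push b x, m => pure (m.setC x (b :: m.cl x), 1)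
  | .pop x, m => pure (m.setC x (m.cl x).tail, 1)
  | .clear x, m => pure (m.setC x [], 1)
  | .prepend x y, m => pure (m.setC y (m.cl x ++ m.cl y), (m.cl x).length + 1)
  | .split u x y, m =>
    let k := (m.cl u).length
    pure ((m.setC x ((m.cl x).drop k)).setC y ((m.cl x).take k), k + 1)
  | .xor x y, m => pure (m.setC y (xorBits (m.cl x) (m.cl y)), (m.cl y).length + 1)
  | .seq c d, m => do
    let (m₁, t₁) ← c.exec m
    let (m₂, t₂) ← d.exec m₁
    return (m₂, t₁ + t₂)
  | .branch x c d e, m => do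
    let (m₁, t₁) ← match m.cl x with
      | true :: _ => c.exec m
      | false :: _ => d.exec m
      | [] => e.exec m
    return (m₁, t₁ + 1)
  | .loop x c, m => iterate c.exec (m.cl x).length m
  | .qloop r c, m => iterate c.exec (m.qu r).length m
  | .qnew r, m => do
    let i ← QComp.fresh
    return (m.setQ r (i :: m.qu r), 1)
  | .had r, m =>
    match m.qu r with
    | [] => pure (m, 1)
    | i :: _ => do
      QComp.gate (hadamard i)
      return (m, 1)
  | .tee r, m =>
    match m.qu r with
    | [] => pure (m, 1)
    | i :: _ => do
      QComp.gate (tGate i)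
      return (m, 1)
  | .cnot r s, m =>
    match m.qu r, m.qu s with
    | i :: _, j :: _ => do
      QComp.gate (cnotGate i j)
      return (m, 1)
    | _, _ => pure (m, 1)
  | .qmove r s, m =>
    match m.qu r with
    | [] => pure (m, 1)
    | i :: l =>
      let m₁ := m.setQ r l
      pure (m₁.setQ s (i :: m₁.qu s), 1)
  | .qappend r s, m =>
    let m₁ := m.setQ r []
    pure (m₁.setQ s (m.qu r ++ m₁.qu s), (m.qu r).length + 1)
  | .meas r x, m =>
    match m.qu r with
    | [] => pure (m, 1)
    | i :: l => do
      let b ← QComp.measure i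
      return ((m.setQ r l).setC x (b :: m.cl x), 1)

/-- Execute a program, forgetting the step count. -/
def Cmd.run (c : Cmd) (m : Mem) : QComp Mem := do
  let r ← c.exec m
  return r.1

/-- The program runs in polynomial time: on every memory whose registers have length at most `n`,
in every state of the qubits and whatever the measurement outcomes, it halts within `p(n)` steps. -/
def PolyTime (c : Cmd) : Prop :=
  ∃ p : ℕ[X], ∀ (n : ℕ) (m : Mem) (L : Lab), m.Bounded n →
    ∀ r ∈ c.exec m L, r.1.2 ≤ p.eval n

/-- The program is classical and deterministic: it has no quantum instructions. -/
def Cmd.Classical : Cmd → Prop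
  | .skip | .push _ _ | .pop _ | .clear _ | .prepend _ _ | .split _ _ _ | .xor _ _ => True
  | .seq c d => c.Classical ∧ d.Classical
  | .branch _ c d e => c.Classical ∧ d.Classical ∧ e.Classical
  | .loop _ c => c.Classical
  | .qloop _ _ | .qnew _ | .had _ | .tee _ | .cnot _ _ | .qmove _ _ | .qappend _ _ | .meas _ _ =>
    False

/-- Rename the registers of a program. `c.rename (.sub j)` is `c` used as the `j`-th subroutine. -/
def Cmd.rename (f : Reg → Reg) : Cmd → Cmd
  | .skip => .skip
  | .push b x => .push b (f x)
  | .pop x => .pop (f x)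
  | .clear x => .clear (f x)
  | .prepend x y => .prepend (f x) (f y)
  | .split u x y => .split (f u) (f x) (f y)
  | .xor x y => .xor (f x) (f y)
  | .seq c d => .seq (c.rename f) (d.rename f)
  | .branch x c d e => .branch (f x) (c.rename f) (d.rename f) (e.rename f)
  | .loop x c => .loop (f x) (c.rename f)
  | .qloop r c => .qloop (f r) (c.rename f)
  | .qnew r => .qnew (f r)
  | .had r => .had (f r)
  | .tee r => .tee (f r)
  | .cnot r s => .cnot (f r) (f s)
  | .qmove r s => .qmove (f r) (f s)
  | .qappend r s => .qappend (f r) (f s)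
  | .meas r x => .meas (f r) (f x)

/-- Run the listed programs one after the other. -/
def Cmd.block : List Cmd → Cmd
  | [] => .skip
  | c :: cs => .seq c (Cmd.block cs)

/-- `y := x` -/
def Cmd.copy (x y : Reg) : Cmd := .seq (.clear y) (.prepend x y)

/-- Push a uniformly random bit on `x`. -/
def Cmd.randomBit (x : Reg) : Cmd :=
  .block [.qnew (.main 0), .had (.main 0), .meas (.main 0) x]

/-! # Strings, lists of strings, asymptotics -/

/-- The string `1^n`. -/
def ones (n : ℕ) : List Bool := List.replicate n true

/-- The string `1^{n₁} 0 1^{n₂} 0 ⋯`, which describes how a concatenation splits into parts. -/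
def encodeLengths : List ℕ → List Bool
  | [] => []
  | n :: ns => ones n ++ false :: encodeLengths ns

/-- The inverse of `encodeLengths` (an unfinished last number is dropped). -/
def decodeLengths : List Bool → List ℕ
  | [] => []
  | false :: w => 0 :: decodeLengths w
  | true :: w =>
    match decodeLengths w with
    | [] => []
    | n :: ns => (n + 1) :: ns

/-- Cut a list into consecutive parts of the given lengths. -/
def cutInto {α : Type} : List ℕ → List α → List (List α)
  | [], _ => []
  | n :: ns, l => l.take n :: cutInto ns (l.drop n)

/-- `ν` is negligible. -/
def Negligible (ν : ℕ → ℝ) : Prop :=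
  Asymptotics.SuperpolynomialDecay Filter.atTop (fun k : ℕ => (k : ℝ)) ν

/-- `γ` is an inverse polynomial. -/
def InversePolynomial (γ : ℕ → ℝ) : Prop :=
  ∃ p : ℕ[X], ∀ k : ℕ, 0 < p.eval k ∧ γ k = 1 / ((p.eval k : ℕ) : ℝ)

/-- The deterministic program `c` computes the length function `ℓ` in polynomial time: on input
`1^k` it outputs a string of length `ℓ k`. -/
def ComputesLength (c : Cmd) (ℓ : ℕ → ℕ) : Prop :=
  c.Classical ∧ PolyTime c ∧ ∀ (k : ℕ) (L : Lab), ∀ r ∈ c.run (Mem.load [ones k] []) L,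
    (r.1.cl (.main 0)).length = ℓ k

/-- Repeat a process `q` times independently and list the results. -/
def repeatComp {α : Type} (q : ℕ) (p : QComp α) : QComp (List α) :=
  (List.range q).mapM fun _ => p

/-! # Single-decryptor encryption -/

/-- The programs of a single-decryptor encryption scheme with plaintext space `{0,1}^{ℓ(k)}`, where
`k` is the security parameter, `ℓ = msgLen`, and `lenProg` computes `ℓ`. Public keys, master secret
keys and ciphertexts are bit strings, decryption keys are lists of qubits. Every algorithm is also
given `1^k`. -/
structure SDE where
  msgLen : ℕ → ℕ
  lenProg : Cmd
  setup : Cmd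
  keyGen : Cmd
  enc : Cmd
  dec : Cmd

namespace SDE

/-- `Setup(1^k) → (pk, msk)` -/
def runSetup (S : SDE) (k : ℕ) : QComp (List Bool × List Bool) := do
  let m ← S.setup.run (Mem.load [ones k] [])
  return (m.cl (.main 0), m.cl (.main 1))

/-- `KG(msk) → sk` -/
def runKeyGen (S : SDE) (k : ℕ) (msk : List Bool) : QComp (List ℕ) := do
  let m ← S.keyGen.run (Mem.load [ones k, msk] [])
  return m.qu (.main 0)

/-- `Enc(pk, msg) → ct` -/
def runEnc (S : SDE) (k : ℕ) (pk msg : List Bool) : QComp (List Bool) := do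
  let m ← S.enc.run (Mem.load [ones k, pk, msg] [])
  return m.cl (.main 0)

/-- `Dec(sk, ct) → msg'`; a string whose length is not `ℓ(k)` stands for `⊥`. -/
def runDec (S : SDE) (k : ℕ) (sk : List ℕ) (ct : List Bool) : QComp (List Bool) := do
  let m ← S.dec.run (Mem.load [ones k, ct] [sk])
  return m.cl (.main 0)

/-- Generate keys, encrypt and decrypt `msg`; is the result `msg`? -/
def correctnessExp (S : SDE) (k : ℕ) (msg : List Bool) : QComp Bool := do
  let (pk, msk) ← (S.runSetup k).isolated
  let sk ← S.runKeyGen k msk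
  let ct ← (S.runEnc k pk msg).isolated
  let msg' ← S.runDec k sk ct
  return decide (msg' = msg)

/-- The algorithms are efficient and decryption is correct. -/
structure IsScheme (S : SDE) : Prop where
  length : ComputesLength S.lenProg S.msgLen
  setup : PolyTime S.setup
  keyGen : PolyTime S.keyGen
  enc : PolyTime S.enc
  dec : PolyTime S.dec
  correct : ∃ ν : ℕ → ℝ, Negligible ν ∧ ∀ (k : ℕ) (msg : List Bool), msg.length = S.msgLen k →
    1 - ν k ≤ (S.correctnessExp k msg).prob

/-- An adversary against anti-piracy. `query` is run on `(1^k, pk)` and chooses `q`; `pirate` goes on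
with the memory that `query` has left, receives the keys, and outputs the registers
`R_1, …, R_{q+1}` together with a classical string `z` that describes the decryptors;
`decrypt` runs the decryptor `i` described by `z` on `R_i` and a ciphertext. -/
structure Adversary where
  query : Cmd
  pirate : Cmd
  decrypt : Cmd

/-- The adversary is efficient. -/
def Adversary.QPT (A : Adversary) : Prop :=
  PolyTime A.query ∧ PolyTime A.pirate ∧ PolyTime A.decrypt

/-- The collusion-resistant identical-challenge search anti-piracy game. -/
def antiPiracyGame (S : SDE) (A : Adversary) (k : ℕ) : QComp Bool := do
  let (pk, msk) ← (S.runSetup k).isolated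
  let mem₁ ← A.query.run (Mem.load [ones k, pk] [])
  let q := (mem₁.cl (.main 0)).length
  let sks ← repeatComp q (S.runKeyGen k msk)
  let mem₂ ← A.pirate.run
    ((mem₁.setC (.main 0) (encodeLengths (sks.map List.length))).setQ (.main 0) sks.flatten)
  let z := mem₂.cl (.main 0)
  let R := cutInto (decodeLengths (mem₂.cl (.main 1))) (mem₂.qu (.main 0))
  let msg ← QComp.uniformBits (S.msgLen k)
  let ct ← (S.runEnc k pk msg).isolated
  let outs ← (List.range (q + 1)).mapM fun i => do
    let m ← A.decrypt.run (Mem.load [ones k, ones (i + 1), z, ct] [R.getD i []])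
    return m.cl (.main 0)
  return decide (∀ out ∈ outs, out = msg)

/-- Collusion-resistant identical-challenge search `γ`-anti-piracy security. -/
def AntiPiracySecureWith (S : SDE) (γ : ℕ → ℝ) : Prop :=
  ∀ A : Adversary, A.QPT → ∃ ν : ℕ → ℝ, Negligible ν ∧ ∀ k : ℕ,
    (S.antiPiracyGame A k).prob ≤ 1 / 2 ^ S.msgLen k + γ k + ν k

/-- Collusion-resistant identical-challenge search anti-piracy security. -/
def AntiPiracySecure (S : SDE) : Prop :=
  ∀ γ : ℕ → ℝ, InversePolynomial γ → S.AntiPiracySecureWith γ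

end SDE

/-! # Unclonable encryption -/

/-- The programs of an unclonable encryption scheme with message space `{0,1}^{ℓ(k)}`. Keys are bit
strings; a ciphertext consists of a bit string and a list of qubits. Every algorithm is also given
`1^k`. -/
structure UE where
  msgLen : ℕ → ℕ
  lenProg : Cmd
  keyGen : Cmd
  enc : Cmd
  dec : Cmd

namespace UE

/-- `KG(1^k) → (ek, dk)` -/
def runKeyGen (U : UE) (k : ℕ) : QComp (List Bool × List Bool) := do
  let m ← U.keyGen.run (Mem.load [ones k] [])
  return (m.cl (.main 0), m.cl (.main 1))

/-- `Enc(ek, msg) → ct` -/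
def runEnc (U : UE) (k : ℕ) (ek msg : List Bool) : QComp (List Bool × List ℕ) := do
  let m ← U.enc.run (Mem.load [ones k, ek, msg] [])
  return (m.cl (.main 0), m.qu (.main 0))

/-- `Dec(dk, ct) → msg'`; a string whose length is not `ℓ(k)` stands for `⊥`. -/
def runDec (U : UE) (k : ℕ) (dk : List Bool) (ct : List Bool × List ℕ) : QComp (List Bool) := do
  let m ← U.dec.run (Mem.load [ones k, dk, ct.1] [ct.2])
  return m.cl (.main 0)

/-- Generate keys, encrypt and decrypt `msg`; is the result `msg`? -/
def correctnessExp (U : UE) (k : ℕ) (msg : List Bool) : QComp Bool := do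
  let (ek, dk) ← (U.runKeyGen k).isolated
  let ct ← U.runEnc k ek msg
  let msg' ← U.runDec k dk ct
  return decide (msg' = msg)

/-- The algorithms are efficient and decryption is correct. -/
structure IsScheme (U : UE) : Prop where
  length : ComputesLength U.lenProg U.msgLen
  keyGen : PolyTime U.keyGen
  enc : PolyTime U.enc
  dec : PolyTime U.dec
  correct : ∃ ν : ℕ → ℝ, Negligible ν ∧ ∀ (k : ℕ) (msg : List Bool), msg.length = U.msgLen k →
    1 - ν k ≤ (U.correctnessExp k msg).prob

/-- An adversary `(A_0, A_1, A_2, …)` against multi-challenge search security. `query` and `clone`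
are the two stages of `A_0` (the second goes on with the memory that the first has left); `clone`
outputs the registers `R_1, …, R_{q+1}` together with a classical string `z`, a copy of which is
part of each of them. `guess`, run with the index `i`, is `A_i`. -/
structure Adversary where
  query : Cmd
  clone : Cmd
  guess : Cmd

/-- The adversary is efficient. -/
def Adversary.QPT (A : Adversary) : Prop :=
  PolyTime A.query ∧ PolyTime A.clone ∧ PolyTime A.guess

/-- The multi-challenge search game. -/
def searchGame (U : UE) (A : Adversary) (k : ℕ) : QComp Bool := do
  let (ek, dk) ← (U.runKeyGen k).isolated
  let mem₁ ← A.query.run (Mem.load [ones k] [])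
  let q := (mem₁.cl (.main 0)).length
  let msg ← QComp.uniformBits (U.msgLen k)
  let cts ← repeatComp q (U.runEnc k ek msg)
  let mem₂ ← A.clone.run
    ((((mem₁.setC (.main 0) (encodeLengths (cts.map fun ct => ct.2.length))).setC
        (.main 1) (cts.map fun ct => ct.1).flatten).setC
        (.main 2) (encodeLengths (cts.map fun ct => ct.1.length))).setQ
        (.main 0) (cts.map fun ct => ct.2).flatten)
  let z := mem₂.cl (.main 0)
  let R := cutInto (decodeLengths (mem₂.cl (.main 1))) (mem₂.qu (.main 0))
  let outs ← (List.range (q + 1)).mapM fun i => do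
    let m ← A.guess.run (Mem.load [ones k, ones (i + 1), z, dk] [R.getD i []])
    return m.cl (.main 0)
  return decide (∀ out ∈ outs, out = msg)

/-- Multi-challenge search security. -/
def SearchSecure (U : UE) : Prop :=
  ∀ A : Adversary, A.QPT → ∃ ν : ℕ → ℝ, Negligible ν ∧ ∀ k : ℕ,
    (U.searchGame A k).prob ≤ 1 / 2 ^ U.msgLen k + ν k

end UE

/-! # Exchanging the roles of keys and ciphertexts -/

namespace SDE

/-- Key generation: `(pk, msk) ← Setup(1^k)`, `s ← {0,1}^ℓ`, `ct ← Enc(pk, s)`; output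
`ek = (msk, s)`, written as the string `s ++ msk`, and `dk = ct`. -/
def ueKeyGen (S : SDE) : Cmd :=
  .block [
    .copy (.main 0) (.sub 0 (.main 0)),
    .copy (.main 0) (.sub 1 (.main 0)),
    .copy (.main 0) (.sub 2 (.main 0)),
    S.lenProg.rename (.sub 0),
    S.setup.rename (.sub 1),
    .loop (.sub 0 (.main 0)) (.randomBit (.main 2)),
    .copy (.sub 1 (.main 0)) (.sub 2 (.main 1)),
    .copy (.main 2) (.sub 2 (.main 2)),
    S.enc.rename (.sub 2),
    .copy (.sub 1 (.main 1)) (.main 0),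
    .prepend (.main 2) (.main 0),
    .copy (.sub 2 (.main 0)) (.main 1)]

/-- Encryption of `msg` under `ek = (msk, s)`: `sk ← KG(msk)`; output `(sk, msg ⊕ s)`. -/
def ueEnc (S : SDE) : Cmd :=
  .block [
    .copy (.main 0) (.sub 0 (.main 0)),
    S.lenProg.rename (.sub 0),
    .split (.sub 0 (.main 0)) (.main 1) (.main 3),
    .copy (.main 0) (.sub 1 (.main 0)),
    .copy (.main 1) (.sub 1 (.main 1)),
    S.keyGen.rename (.sub 1),
    .qappend (.sub 1 (.main 0)) (.main 0),
    .copy (.main 2) (.main 0),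
    .xor (.main 3) (.main 0)]

/-- Decryption of `(sk, μ)` under `dk = ct`: `s' ← Dec(sk, ct)`; output `μ ⊕ s'`. -/
def ueDec (S : SDE) : Cmd :=
  .block [
    .copy (.main 0) (.sub 0 (.main 0)),
    .copy (.main 1) (.sub 0 (.main 1)),
    .qappend (.main 0) (.sub 0 (.main 0)),
    S.dec.rename (.sub 0),
    .copy (.sub 0 (.main 0)) (.main 0),
    .xor (.main 2) (.main 0)]

/-- The unclonable encryption scheme obtained from `S` by exchanging the roles of keys and
ciphertexts. -/
def toUE (S : SDE) : UE where
  msgLen := S.msgLen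
  lenProg := S.lenProg
  keyGen := S.ueKeyGen
  enc := S.ueEnc
  dec := S.ueDec

end SDE

end Unclonable

end

open scoped Polynomial

noncomputable section

namespace Unclonable

/-! # Processes: monad laws, expectations, simulations -/

namespace QComp

variable {α β γ δ : Type}

/-! The reduction is a one-time-pad argument and loses nothing. In the search game all ciphertexts
have the form `(sk_i, m ⊕ s)`, and the guessers later receive `Enc(pk, s)`. Since `m` is uniform and
independent of `s`, the mask `r = m ⊕ s` is uniform and independent of `s` as well, and the cloner
sees nothing else that depends on `m` or `s`. A pirate can therefore draw `r` itself, attach it to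
its `q` keys, run the cloner, and ship `r` with the decryptors; the challenge ciphertext of the
anti-piracy game plays the part of the decryption key. A guess equals `m = r ⊕ s` exactly if the
guess with `r` added equals `s`, so the two winning probabilities coincide
(`SDE.prob_antiPiracyGame_pirate`). Anti-piracy then bounds the advantage over `2^{-ℓ}` by `γ` plus
a negligible function, for every inverse polynomial `γ`, and a nonnegative function with this
property is negligible (`negligible_of_le`). Correctness rests on the same cancellation: the success
probability of the new scheme is the average over `s` of that of the old one.

The labour is to show that two experiments, given by programs acting on a common laboratory, have
equal iterated expectations. Two tools do this. - Processes are `Homogeneous` in the norm of the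
state. Coins and isolated subroutines can therefore be pulled out of `expect` as `average` and
`mean`, and finite sums interchange; this takes care of the different orders of sampling in the two
games. - Execution commutes with renaming the qubits and tensoring with an unrelated state
(`simulates_exec`). Special cases are homogeneity itself, the irrelevance of leftover qubits to a
subroutine with classical input (`QComp.expect_run_classical`), and the irrelevance of skipped qubit
names (`UE.expect_clonePhase_bump`).

Efficiency of the new programs follows because a step lengthens registers by at most one
(`growsSlowly_exec`), so that polynomial bounds compose. -/

theorem pure_apply (a : α) (L : Lab) : (pure a : QComp α) L = [(a, L)] := rfl

theorem bind_apply (p : QComp α) (f : α → QComp β) (L : Lab) :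
    (p >>= f) L = (p L).flatMap fun r => f r.1 r.2 := rfl

instance : LawfulMonad QComp := LawfulMonad.mk'
  (id_map := fun p => by
    funext L
    change (p L).flatMap (fun r => [(r.1, r.2)]) = p L
    simp)
  (pure_bind := fun a f => by
    funext L
    change [(a, L)].flatMap (fun r => f r.1 r.2) = f a L
    simp)
  (bind_assoc := fun p f g => by
    funext L
    simp only [bind_apply, List.flatMap_assoc])

theorem map_apply (f : α → β) (p : QComp α) (L : Lab) :
    (f <$> p) L = (p L).map fun r => (f r.1, r.2) := by
  rw [← bind_pure_comp, bind_apply]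
  simp only [pure_apply]
  exact List.flatMap_pure_eq_map (fun r : α × Lab => (f r.1, r.2)) (p L)

/-- The sum over all branches of the value that `G` assigns to them. -/
def expect (p : QComp α) (G : α → Lab → ℝ) (L : Lab) : ℝ :=
  ((p L).map fun r => G r.1 r.2).sum

@[simp]
theorem expect_pure (a : α) (G : α → Lab → ℝ) : expect (pure a) G = G a := by
  funext L
  simp [expect, pure_apply]

theorem expect_bind (p : QComp α) (f : α → QComp β) (G : β → Lab → ℝ) :
    expect (p >>= f) G = expect p fun a => expect (f a) G := by
  funext L
  simp only [expect, bind_apply]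
  induction p L with
  | nil => simp
  | cons r l ih => simp [ih]

theorem expect_map (f : α → β) (p : QComp α) (G : β → Lab → ℝ) :
    expect (f <$> p) G = expect p fun a => G (f a) := by
  rw [← bind_pure_comp, expect_bind]
  simp only [expect_pure]

theorem expect_congr {p : QComp α} {G H : α → Lab → ℝ} {L : Lab}
    (h : ∀ r ∈ p L, G r.1 r.2 = H r.1 r.2) : expect p G L = expect p H L := by
  rw [expect, expect, List.map_congr_left h]

theorem expect_add (p : QComp α) (G H : α → Lab → ℝ) (L : Lab) :
    expect p (fun a L => G a L + H a L) L = expect p G L + expect p H L :=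
  List.sum_map_add

theorem expect_mul_left (p : QComp α) (c : ℝ) (G : α → Lab → ℝ) (L : Lab) :
    expect p (fun a L => c * G a L) L = c * expect p G L :=
  List.sum_map_mul_left ..

/-- Fubini for finite sums: two processes in separate laboratories can be run in either order. -/
theorem expect_comm (p : QComp α) (q : QComp β) (G : α → β → Lab → Lab → ℝ) (L M : Lab) :
    expect p (fun a L => expect q (fun b M => G a b L M) M) L =
      expect q (fun b M => expect p (fun a L => G a b L M) L) M := by
  simp only [expect]
  induction p L with
  | nil => simp
  | cons r l ih => simp [ih, List.sum_map_add]

/-- The value of a branch with a Boolean result: its probability if the result is `true`. -/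
def accept (b : Bool) (L : Lab) : ℝ := if b then L.weight else 0

theorem prob_eq_expect (p : QComp Bool) : p.prob = expect p accept Lab.vacuum := rfl

/-- Started on the `Φ`-image of a state that satisfies `P`, the process `p'` has the images of the
branches of `p`, where `u` translates the results; and `p` preserves `P`. -/
def Simulates (Φ : Lab → Lab) (P : Lab → Prop) (u : α → β) (p : QComp α) (p' : QComp β) : Prop :=
  ∀ L, P L → p' (Φ L) = (p L).map (Prod.map u Φ) ∧ ∀ r ∈ p L, P r.2

section Simulates

variable {Φ : Lab → Lab} {P : Lab → Prop}

theorem Simulates.pure {u : α → β} {a : α} {b : β} (h : b = u a) :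
    Simulates Φ P u (pure a) (pure b) := by
  intro L hL
  subst h
  simpa [pure_apply] using hL

theorem Simulates.bind {u : α → β} {v : γ → δ} {p : QComp α} {p' : QComp β} {f : α → QComp γ}
    {f' : β → QComp δ} (hp : Simulates Φ P u p p')
    (hf : ∀ a, Simulates Φ P v (f a) (f' (u a))) :
    Simulates Φ P v (p >>= f) (p' >>= f') := by
  intro L hL
  obtain ⟨h₁, h₂⟩ := hp L hL
  refine ⟨?_, ?_⟩
  · rw [bind_apply, bind_apply, h₁, List.flatMap_map, List.map_flatMap]
    exact List.flatMap_congr fun r hr => (hf r.1 r.2 (h₂ r hr)).1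
  · intro r hr
    rw [bind_apply, List.mem_flatMap] at hr
    obtain ⟨s, hs, hr⟩ := hr
    exact (hf s.1 s.2 (h₂ s hs)).2 r hr

theorem Simulates.mapM {ι : Type} {f f' : ι → QComp α} (h : ∀ i, Simulates Φ P id (f i) (f' i)) :
    ∀ l : List ι, Simulates Φ P id (l.mapM f) (l.mapM f')
  | [] => by
    rw [List.mapM_nil, List.mapM_nil]
    exact Simulates.pure rfl
  | i :: l => by
    simp only [List.mapM_cons]
    exact (h i).bind fun a => (Simulates.mapM h l).bind fun b => Simulates.pure rfl

theorem Simulates.expect {u : α → β} {p : QComp α} {p' : QComp β} (h : Simulates Φ P u p p')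
    {G : α → Lab → ℝ} {G' : β → Lab → ℝ} {c : ℝ} (hG : ∀ a L, P L → G' (u a) (Φ L) = c * G a L)
    {L : Lab} (hL : P L) : expect p' G' (Φ L) = c * expect p G L := by
  obtain ⟨h₁, h₂⟩ := h L hL
  rw [QComp.expect, h₁, ← expect_mul_left, QComp.expect, List.map_map]
  exact congrArg List.sum (List.map_congr_left fun r hr => hG r.1 r.2 (h₂ r hr))

end Simulates

/-- The process does not depend on the normalisation of the state. -/
def Homogeneous (p : QComp α) : Prop :=
  ∀ c : ℝ, 0 ≤ c → Simulates (Lab.scale c) (fun _ => True) id p p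

end QComp

/-! ### Scaling of branches, and averages over classical randomness. -/

theorem Lab.scale_comm (c d : ℝ) (L : Lab) : (L.scale c).scale d = (L.scale d).scale c := by
  rw [Lab.scale, Lab.scale, Lab.scale, Lab.scale, smul_comm]

theorem Lab.weight_eq_sum {L : Lab} {s : Finset (Finset ℕ)} (h : L.amp.support ⊆ s) :
    L.weight = ∑ S ∈ s, ‖L.amp S‖ ^ 2 := by
  refine Finset.sum_subset h fun S _ hS => ?_
  simp [Finsupp.notMem_support_iff.1 hS]

theorem Lab.weight_nonneg (L : Lab) : 0 ≤ L.weight :=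
  Finset.sum_nonneg fun _ _ => by positivity

theorem Lab.weight_scale {c : ℝ} (hc : 0 ≤ c) (L : Lab) : (L.scale c).weight = c * L.weight := by
  rw [Lab.weight_eq_sum (L := L.scale c) (s := L.amp.support) Finsupp.support_smul, Lab.weight,
    Finset.mul_sum]
  refine Finset.sum_congr rfl fun S _ => ?_
  simp [Lab.scale, mul_pow, Real.sq_sqrt hc]

namespace QComp

variable {α β : Type}

theorem Homogeneous.pure (a : α) : Homogeneous (pure a) := fun _ _ => Simulates.pure rfl

theorem Homogeneous.bind {p : QComp α} {f : α → QComp β} (hp : Homogeneous p)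
    (hf : ∀ a, Homogeneous (f a)) : Homogeneous (p >>= f) :=
  fun c hc => (hp c hc).bind fun a => hf a c hc

theorem Homogeneous.mapM {ι : Type} {f : ι → QComp α} (h : ∀ i, Homogeneous (f i)) (l : List ι) :
    Homogeneous (l.mapM f) := fun c hc => Simulates.mapM (fun i => h i c hc) l

theorem Homogeneous.repeatComp {p : QComp α} (h : Homogeneous p) (q : ℕ) :
    Homogeneous (repeatComp q p) := Homogeneous.mapM (fun _ => h) _

theorem Homogeneous.isolated (p : QComp α) : Homogeneous p.isolated := by
  intro c _ L _
  simp [QComp.isolated, Lab.scale_comm c]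

theorem Homogeneous.coin : Homogeneous coin := by
  intro c _ L _
  simp [QComp.coin, Lab.scale_comm c]

theorem Homogeneous.uniformBits : ∀ k, Homogeneous (uniformBits k)
  | 0 => Homogeneous.pure _
  | k + 1 => Homogeneous.coin.bind fun _ =>
      (Homogeneous.uniformBits k).bind fun _ => Homogeneous.pure _

theorem accept_scale {c : ℝ} (hc : 0 ≤ c) (b : Bool) (L : Lab) :
    accept b (L.scale c) = c * accept b L := by
  cases b <;> simp [accept, Lab.weight_scale hc]

theorem Homogeneous.expect_scale {p : QComp α} (h : Homogeneous p) {G : α → Lab → ℝ}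
    (hG : ∀ c, 0 ≤ c → ∀ a L, G a (L.scale c) = c * G a L) {c : ℝ} (hc : 0 ≤ c) (L : Lab) :
    expect p G (L.scale c) = c * expect p G L :=
  (h c hc).expect (P := fun _ => True) (fun a L _ => hG c hc a L) trivial

/-- The expectation of a function of the classical result of a process that is run in a laboratory
of its own. -/
def mean (p : QComp α) (f : α → ℝ) : ℝ := expect p (fun a L => L.weight * f a) Lab.vacuum

/-- An isolated run touches the ambient laboratory only by scaling it with the weight of the branch,
and a homogeneous `G` releases that factor. -/
theorem expect_isolated (p : QComp α) {G : α → Lab → ℝ}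
    (hG : ∀ c, 0 ≤ c → ∀ a L, G a (L.scale c) = c * G a L) (L : Lab) :
    expect p.isolated G L = mean p fun a => G a L := by
  simp only [expect, isolated, mean, List.map_map]
  exact congrArg List.sum (List.map_congr_left fun r _ => hG _ r.2.weight_nonneg _ _)

theorem expect_mean (p : QComp α) (q : QComp β) (G : β → α → Lab → ℝ) (L : Lab) :
    expect p (fun a L => mean q fun b => G b a L) L = mean q fun b => expect p (G b) L := by
  simp only [mean, ← expect_mul_left]
  exact expect_comm ..

theorem mean_congr {p : QComp α} {f g : α → ℝ} (h : ∀ a, f a = g a) : mean p f = mean p g := by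
  rw [funext h]

/-- The average of a function over all strings of `k` bits. -/
def average : ℕ → (List Bool → ℝ) → ℝ
  | 0, f => f []
  | k + 1, f =>
    1 / 2 * average k (fun w => f (false :: w)) + 1 / 2 * average k (fun w => f (true :: w))

theorem average_congr {k : ℕ} {f g : List Bool → ℝ} (h : ∀ w, w.length = k → f w = g w) :
    average k f = average k g := by
  induction k generalizing f g with
  | zero => exact h _ rfl
  | succ k ih =>
    simp only [average]
    rw [ih fun w hw => h (false :: w) (by simp [hw]), ih fun w hw => h (true :: w) (by simp [hw])]

theorem average_const (k : ℕ) (c : ℝ) : average k (fun _ => c) = c := by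
  induction k with
  | zero => rfl
  | succ k ih => simp only [average, ih]; ring

theorem average_mono {k : ℕ} {f g : List Bool → ℝ} (h : ∀ w, w.length = k → f w ≤ g w) :
    average k f ≤ average k g := by
  induction k generalizing f g with
  | zero => exact h _ rfl
  | succ k ih =>
    have h₁ := ih fun w hw => h (false :: w) (by simp [hw])
    have h₂ := ih fun w hw => h (true :: w) (by simp [hw])
    simp only [average]
    linarith

theorem average_mul_left (k : ℕ) (c : ℝ) (f : List Bool → ℝ) :
    average k (fun w => c * f w) = c * average k f := by
  induction k generalizing f with
  | zero => rfl
  | succ k ih => simp only [average, ih]; ring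

theorem average_append_singleton (k : ℕ) (f : List Bool → ℝ) :
    average (k + 1) f =
      1 / 2 * average k (fun w => f (w ++ [false])) +
        1 / 2 * average k (fun w => f (w ++ [true])) := by
  induction k generalizing f with
  | zero => rfl
  | succ k ih =>
    rw [average, ih, ih]
    simp only [average, List.cons_append]
    ring

/-- Adding a fixed string permutes the strings of its length. This is the one-time pad. -/
theorem average_xorBits (k : ℕ) {s : List Bool} (hs : s.length = k) (f : List Bool → ℝ) :
    average k (fun w => f (xorBits s w)) = average k f := by
  induction k generalizing s f with
  | zero => simp [average, xorBits]
  | succ k ih =>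
    obtain ⟨b, s, rfl⟩ := List.exists_cons_of_length_eq_add_one hs
    have hs' : s.length = k := by simpa using hs
    cases b <;> simp only [average, xorBits, Bool.xor_false, Bool.xor_true, Bool.not_false,
      Bool.not_true, ih hs' (fun w => f (true :: w)), ih hs' (fun w => f (false :: w))]
    ring

theorem expect_average (p : QComp α) (k : ℕ) (G : List Bool → α → Lab → ℝ) (L : Lab) :
    expect p (fun a L => average k fun w => G w a L) L = average k fun w => expect p (G w) L := by
  induction k generalizing G with
  | zero => rfl
  | succ k ih => simp only [average, expect_add, expect_mul_left, ih]

theorem mean_average (p : QComp α) (k : ℕ) (g : List Bool → α → ℝ) :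
    mean p (fun a => average k fun w => g w a) = average k fun w => mean p (g w) := by
  simp only [mean, ← average_mul_left]
  exact expect_average p k (fun w a L => L.weight * g w a) _

theorem average_add (k : ℕ) (f g : List Bool → ℝ) :
    average k (fun w => f w + g w) = average k f + average k g := by
  induction k generalizing f g with
  | zero => rfl
  | succ k ih => simp only [average, ih]; ring

theorem average_comm (j k : ℕ) (f : List Bool → List Bool → ℝ) :
    average j (fun v => average k (f v)) = average k fun w => average j fun v => f v w := by
  induction k generalizing f with
  | zero => rfl
  | succ k ih => simp only [average, average_add, average_mul_left, ih]

theorem expect_uniformBits (k : ℕ) {G : List Bool → Lab → ℝ}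
    (hG : ∀ c, 0 ≤ c → ∀ a L, G a (L.scale c) = c * G a L) (L : Lab) :
    expect (uniformBits k) G L = average k fun w => G w L := by
  induction k generalizing G L with
  | zero => simp [uniformBits, average]
  | succ k ih =>
    simp only [uniformBits, bind_pure_comp, expect_bind]
    change List.sum (List.map _ [_, _]) = _
    simp only [List.map_cons, List.map_nil, List.sum_cons, List.sum_nil, add_zero, average]
    rw [expect_map, expect_map, ih fun c hc a => hG c hc _, ih fun c hc a => hG c hc _]
    simp only [hG (1 / 2) (by norm_num), average_mul_left]

end QComp

/-! # Embedding the qubits into a larger laboratory -/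

/-- Make room for `d` qubits with the names `n, …, n + d - 1`. -/
def shift (n d i : ℕ) : ℕ := if i < n then i else i + d

theorem shift_injective (n d : ℕ) : Function.Injective (shift n d) := by
  intro i j h
  unfold shift at h
  split_ifs at h <;> omega

@[simp]
theorem shift_zero_right (n : ℕ) : shift n 0 = id := by
  funext i
  simp [shift]

theorem shift_succ {n i : ℕ} (d : ℕ) (h : n ≤ i) : shift n d (i + 1) = shift n d i + 1 := by
  unfold shift
  split_ifs <;> omega

/-- The basis state in which the old qubits are in state `S` and the new ones in state `T`. -/
def joinSets (n d : ℕ) (T S : Finset ℕ) : Finset ℕ := S.image (shift n d) ∪ T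

/-- All elements of `T` lie in the room that `shift n d` makes. -/
def InRoom (n d : ℕ) (T : Finset ℕ) : Prop := ∀ i ∈ T, n ≤ i ∧ i < n + d

section JoinSets

variable {n d : ℕ} {T : Finset ℕ}

theorem InRoom.shift_notMem (hT : InRoom n d T) (i : ℕ) : shift n d i ∉ T := by
  intro h
  have := hT _ h
  unfold shift at this
  split_ifs at this <;> omega

theorem InRoom.shift_mem_joinSets (hT : InRoom n d T) {S : Finset ℕ} {i : ℕ} :
    shift n d i ∈ joinSets n d T S ↔ i ∈ S := by
  simp [joinSets, hT.shift_notMem, (shift_injective n d).eq_iff]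

theorem InRoom.joinSets_erase (hT : InRoom n d T) (S : Finset ℕ) (i : ℕ) :
    joinSets n d T (S.erase i) = (joinSets n d T S).erase (shift n d i) := by
  rw [joinSets, joinSets, Finset.image_erase (shift_injective n d), Finset.erase_union_distrib,
    Finset.erase_eq_of_notMem (hT.shift_notMem i)]

theorem joinSets_insert (S : Finset ℕ) (i : ℕ) :
    joinSets n d T (insert i S) = insert (shift n d i) (joinSets n d T S) := by
  rw [joinSets, joinSets, Finset.image_insert, Finset.insert_union]

theorem InRoom.joinSets_symmDiff (hT : InRoom n d T) (S : Finset ℕ) (i : ℕ) :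
    joinSets n d T (symmDiff S {i}) = symmDiff (joinSets n d T S) {shift n d i} := by
  have h := hT.shift_notMem i
  ext j
  simp only [joinSets, Finset.mem_union, Finset.mem_image, Finset.mem_symmDiff,
    Finset.mem_singleton]
  constructor
  · rintro (⟨a, ⟨ha, hai⟩ | ⟨rfl, ha⟩, rfl⟩ | hj)
    · exact Or.inl ⟨Or.inl ⟨a, ha, rfl⟩, fun h => hai (shift_injective n d h)⟩
    · refine Or.inr ⟨rfl, ?_⟩
      rintro (⟨b, hb, hab⟩ | h')
      · exact ha (shift_injective n d hab ▸ hb)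
      · exact h h'
    · exact Or.inl ⟨Or.inr hj, fun h' => h (h' ▸ hj)⟩
  · rintro (⟨⟨a, ha, rfl⟩ | hj, hji⟩ | ⟨rfl, hj⟩)
    · exact Or.inl ⟨a, Or.inl ⟨ha, fun h => hji (h ▸ rfl)⟩, rfl⟩
    · exact Or.inr hj
    · exact Or.inl ⟨i, Or.inr ⟨rfl, fun hi => hj (Or.inl ⟨i, hi, rfl⟩)⟩, rfl⟩

/-- Inside the room one reads off `T`, outside of it the shifted copy of `S`. -/
theorem joinSets_injective {T' S S' : Finset ℕ} (hT : InRoom n d T) (hT' : InRoom n d T')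
    (h : joinSets n d T S = joinSets n d T' S') : S = S' ∧ T = T' := by
  have hS : S = S' := by
    ext i
    rw [← hT.shift_mem_joinSets, h, hT'.shift_mem_joinSets]
  subst hS
  refine ⟨rfl, ?_⟩
  have key : ∀ {T₁ T₂ : Finset ℕ}, InRoom n d T₁ →
      joinSets n d T₁ S = joinSets n d T₂ S → T₁ ⊆ T₂ := by
    intro T₁ T₂ h₁ h₁₂ i hi
    have hmem : i ∈ joinSets n d T₂ S := h₁₂ ▸ Finset.mem_union_right _ hi
    rcases Finset.mem_union.1 hmem with hS | h₂
    · obtain ⟨j, -, rfl⟩ := Finset.mem_image.1 hS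
      exact absurd hi (h₁.shift_notMem j)
    · exact h₂
  exact (key hT h).antisymm (key hT' h.symm)

end JoinSets

/-- The joint state of the old qubits in the given state and of the new ones in state `E`. -/
def embed (n d : ℕ) (E : Amp) : Amp →ₗ[ℂ] Amp :=
  ∑ T ∈ E.support, E T • Finsupp.lmapDomain ℂ ℂ (joinSets n d T)

/-- All new qubits have their names in the room that `shift n d` makes. -/
def SupportedInRoom (n d : ℕ) (E : Amp) : Prop := ∀ T ∈ E.support, InRoom n d T

/-- Both sides are linear, so it suffices to compare them on basis states, separately for each
component `T` of `E`. -/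
theorem embed_commute {n d : ℕ} {E : Amp} (hE : SupportedInRoom n d E) {g g' : Amp →ₗ[ℂ] Amp}
    (h : ∀ T, InRoom n d T → ∀ S, g' (Finsupp.single (joinSets n d T S) 1) =
      Finsupp.mapDomain (joinSets n d T) (g (Finsupp.single S 1))) (v : Amp) :
    g' (embed n d E v) = embed n d E (g v) := by
  simp only [embed, LinearMap.sum_apply, LinearMap.smul_apply, map_sum, map_smul]
  refine Finset.sum_congr rfl fun T hT => ?_
  congr 1
  have : g' ∘ₗ Finsupp.lmapDomain ℂ ℂ (joinSets n d T) =
      Finsupp.lmapDomain ℂ ℂ (joinSets n d T) ∘ₗ g := by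
    refine Finsupp.lhom_ext' fun S => LinearMap.ext_ring ?_
    simpa [Finsupp.mapDomain_single] using h T (hE T hT) S
  exact LinearMap.congr_fun this v

section Gates

variable {n d : ℕ} {E : Amp}

theorem hadamard_embed (hE : SupportedInRoom n d E) (i : ℕ) (v : Amp) :
    hadamard (shift n d i) (embed n d E v) = embed n d E (hadamard i v) := by
  refine embed_commute hE (fun T hT S => ?_) v
  simp only [hadamard, Finsupp.linearCombination_single, one_smul, Finsupp.mapDomain_smul,
    Finsupp.mapDomain_add, Finsupp.mapDomain_single, hT.joinSets_erase, joinSets_insert,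
    hT.shift_mem_joinSets]

theorem tGate_embed (hE : SupportedInRoom n d E) (i : ℕ) (v : Amp) :
    tGate (shift n d i) (embed n d E v) = embed n d E (tGate i v) := by
  refine embed_commute hE (fun T hT S => ?_) v
  simp only [tGate, Finsupp.linearCombination_single, one_smul, Finsupp.mapDomain_single,
    hT.shift_mem_joinSets]

theorem cnotGate_embed (hE : SupportedInRoom n d E) (i j : ℕ) (v : Amp) :
    cnotGate (shift n d i) (shift n d j) (embed n d E v) = embed n d E (cnotGate i j v) := by
  refine embed_commute hE (fun T hT S => ?_) v
  simp only [cnotGate, Finsupp.linearCombination_single, one_smul, Finsupp.mapDomain_single,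
    hT.shift_mem_joinSets, (shift_injective n d).ne_iff]
  split_ifs <;> simp only [hT.joinSets_symmDiff]

theorem collapse_embed (hE : SupportedInRoom n d E) (i : ℕ) (b : Bool) (v : Amp) :
    collapse (shift n d i) b (embed n d E v) = embed n d E (collapse i b v) := by
  refine embed_commute hE (fun T hT S => ?_) v
  simp only [collapse, Finsupp.linearCombination_single, one_smul, hT.shift_mem_joinSets]
  split_ifs <;> simp only [hT.joinSets_erase, Finsupp.mapDomain_single, Finsupp.mapDomain_zero]

end Gates

/-- The squared norm of a state vector. -/
def normSq (v : Amp) : ℝ := ∑ S ∈ v.support, ‖v S‖ ^ 2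

theorem Lab.weight_eq_normSq (L : Lab) : L.weight = normSq L.amp := rfl

theorem sum_norm_sq_mapDomain {ι : Type} [DecidableEq ι] (x : ι →₀ ℂ) (f : ι → Finset ℕ)
    (hf : Set.InjOn f x.support) :
    normSq (Finsupp.mapDomain f x) = ∑ a ∈ x.support, ‖x a‖ ^ 2 := by
  rw [normSq, Finsupp.mapDomain_support_of_injOn x hf, Finset.sum_image hf]
  refine Finset.sum_congr rfl fun a ha => ?_
  rw [Finsupp.mapDomain_apply' _ _ subset_rfl hf ha]

/-- The norm of a tensor product is the product of the norms: distinct pairs of basis states have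
distinct joint basis states, so no amplitudes are added up. -/
theorem normSq_embed {n d : ℕ} {E : Amp} (hE : SupportedInRoom n d E) (v : Amp) :
    normSq (embed n d E v) = normSq E * normSq v := by
  classical
  -- The coefficients of the tensor product, indexed by pairs before they are joined.
  let x : (Finset ℕ × Finset ℕ) →₀ ℂ :=
    Finsupp.onFinset (E.support ×ˢ v.support) (fun p => E p.1 * v p.2) fun p hp => by
      simpa [not_or] using hp
  have hsupp : x.support = E.support ×ˢ v.support := by
    ext p
    simp [x, not_or]
  have hx : embed n d E v = Finsupp.mapDomain (fun p => joinSets n d p.1 p.2) x := by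
    rw [Finsupp.mapDomain, Finsupp.sum, hsupp, Finset.sum_product, embed, LinearMap.sum_apply]
    refine Finset.sum_congr rfl fun T _ => ?_
    simp [Finsupp.mapDomain, Finsupp.sum, Finset.smul_sum, x]
  rw [hx, sum_norm_sq_mapDomain, hsupp, Finset.sum_product, normSq, normSq, Finset.sum_mul_sum]
  · simp [x, mul_pow]
  · intro p hp q hq h
    rw [Finset.mem_coe, hsupp, Finset.mem_product] at hp hq
    obtain ⟨h₁, h₂⟩ := joinSets_injective (hE _ hp.1) (hE _ hq.1) h
    exact Prod.ext h₂ h₁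

/-- Place the contents of a laboratory in a larger one, together with new qubits in state `E`. -/
def Lab.embed (n d : ℕ) (E : Amp) (L : Lab) : Lab :=
  ⟨Unclonable.embed n d E L.amp, shift n d L.next⟩

theorem Lab.weight_embed {n d : ℕ} {E : Amp} (hE : SupportedInRoom n d E) (L : Lab) :
    (L.embed n d E).weight = normSq E * L.weight :=
  normSq_embed hE L.amp

/-- All qubits that are not in state `|0⟩` have been allocated. -/
def Lab.WF (L : Lab) : Prop := ∀ S ∈ L.amp.support, ∀ i ∈ S, i < L.next

theorem Lab.WF.vacuum : Lab.vacuum.WF := by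
  intro S hS i hi
  have := Finsupp.support_single_subset hS
  simp_all

/-- The vacuum has no qubits of its own, so all of `L` can be the added part. A run in `L` is
thereby compared with a run in the vacuum. -/
theorem Lab.eq_embed_vacuum {L : Lab} (hL : L.WF) :
    SupportedInRoom 0 L.next L.amp ∧ Lab.vacuum.embed 0 L.next L.amp = L := by
  refine ⟨fun S hS i hi => ⟨i.zero_le, by simpa using hL S hS i hi⟩, ?_⟩
  cases L with
  | mk v k =>
    simp only [Lab.embed, Lab.vacuum, shift, Unclonable.embed, LinearMap.sum_apply,
      LinearMap.smul_apply, Finsupp.lmapDomain_apply, Finsupp.mapDomain_single, joinSets,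
      Finset.image_empty, Finset.empty_union, Finsupp.smul_single_one, lt_irrefl, if_false,
      zero_add]
    rw [show ∑ x ∈ v.support, Finsupp.single x (v x) = v from v.sum_single]

theorem image_shift_eq_self {n : ℕ} {S : Finset ℕ} (d : ℕ) (h : ∀ i ∈ S, i < n) :
    S.image (shift n d) = S := by
  conv_rhs => rw [← Finset.image_id (s := S)]
  exact Finset.image_congr fun i hi => if_pos (h i hi)

/-- If the shift moves no qubit in use and the added qubits are all in `|0⟩`, the embedding is
multiplication by a scalar. With `d = 0` this yields the scaling of a laboratory, with `c = 1` the
skipping of `d` names. -/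
theorem embed_smul_vacuum {n : ℕ} (d : ℕ) (c : ℂ) {v : Amp}
    (hv : ∀ S ∈ v.support, S.image (shift n d) = S) :
    embed n d (c • Finsupp.single ∅ 1) v = c • v := by
  by_cases hc : c = 0
  · simp [embed, hc]
  have hs : (c • Finsupp.single ∅ 1 : Amp).support = {∅} := by
    rw [Finsupp.smul_single_one, Finsupp.support_single _ hc]
  rw [embed, hs, Finset.sum_singleton]
  simp only [LinearMap.smul_apply, Finsupp.lmapDomain_apply, Finsupp.smul_apply,
    Finsupp.single_eq_same, smul_eq_mul, mul_one]
  congr 1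
  conv_rhs => rw [← Finsupp.mapDomain_id (v := v)]
  refine Finsupp.mapDomain_congr fun S hS => ?_
  simpa [joinSets] using hv S hS

theorem supportedInRoom_smul_vacuum (n d : ℕ) (c : ℂ) :
    SupportedInRoom n d (c • Finsupp.single ∅ 1) := by
  intro T hT i hi
  have := Finsupp.support_single_subset (Finsupp.support_smul hT)
  simp_all

theorem normSq_smul_vacuum (c : ℂ) : normSq (c • Finsupp.single ∅ 1) = ‖c‖ ^ 2 := by
  by_cases hc : c = 0
  · simp [normSq, hc]
  · rw [normSq, Finsupp.smul_single_one, Finsupp.support_single _ hc]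
    simp

theorem Lab.WF.embed_vacuum {L : Lab} (hL : L.WF) (d : ℕ) :
    L.embed L.next d (Finsupp.single ∅ 1) = ⟨L.amp, L.next + d⟩ := by
  have := embed_smul_vacuum d 1 fun S hS => image_shift_eq_self d (hL S hS)
  rw [one_smul, one_smul] at this
  simp [Lab.embed, this, shift]

theorem Lab.embed_zero_smul_vacuum (p : ℝ) (L : Lab) :
    L.embed 0 0 (((√p : ℝ) : ℂ) • Finsupp.single ∅ 1) = L.scale p := by
  rw [Lab.embed, embed_smul_vacuum 0 _ fun S _ => by simp]
  simp [Lab.scale]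


/-! # Memories and the execution of programs -/

/-- Rename the qubits in a memory. -/
def Mem.mapQ (σ : ℕ → ℕ) (m : Mem) : Mem := ⟨m.cl, fun r => (m.qu r).map σ⟩

/-- All qubits in the memory have names below `n`. -/
def Mem.WF (m : Mem) (n : ℕ) : Prop := ∀ r, ∀ i ∈ m.qu r, i < n

/-- The registers of the `j`-th subroutine. -/
def Mem.pull (j : ℕ) (m : Mem) : Mem := ⟨fun r => m.cl (.sub j r), fun r => m.qu (.sub j r)⟩

/-- Overwrite the registers of the `j`-th subroutine. -/
def Mem.put (j : ℕ) (m m' : Mem) : Mem where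
  cl
    | .main i => m.cl (.main i)
    | .sub i r => if i = j then m'.cl r else m.cl (.sub i r)
  qu
    | .main i => m.qu (.main i)
    | .sub i r => if i = j then m'.qu r else m.qu (.sub i r)

namespace Mem

@[ext]
theorem ext {m m' : Mem} (h₁ : ∀ x, m.cl x = m'.cl x) (h₂ : ∀ r, m.qu r = m'.qu r) : m = m' := by
  cases m
  cases m'
  simp only [Mem.mk.injEq]
  exact ⟨funext h₁, funext h₂⟩

section Access

variable (m m' m'' : Mem) (x y r s : Reg) (w v : List Bool) (l : List ℕ) (i j : ℕ)

@[simp] theorem cl_setC : (m.setC x w).cl y = if y = x then w else m.cl y := by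
  simp [setC, Function.update_apply]
@[simp] theorem qu_setC : (m.setC x w).qu r = m.qu r := rfl
@[simp] theorem cl_setQ : (m.setQ r l).cl x = m.cl x := rfl
@[simp] theorem qu_setQ : (m.setQ r l).qu s = if s = r then l else m.qu s := by
  simp [setQ, Function.update_apply]
@[simp] theorem cl_mapQ (σ : ℕ → ℕ) : (m.mapQ σ).cl x = m.cl x := rfl
@[simp] theorem qu_mapQ (σ : ℕ → ℕ) : (m.mapQ σ).qu r = (m.qu r).map σ := rfl
@[simp] theorem cl_pull : (m.pull j).cl x = m.cl (.sub j x) := rfl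
@[simp] theorem qu_pull : (m.pull j).qu r = m.qu (.sub j r) := rfl
@[simp] theorem cl_put_main : (m.put j m').cl (.main i) = m.cl (.main i) := rfl
@[simp] theorem qu_put_main : (m.put j m').qu (.main i) = m.qu (.main i) := rfl
@[simp] theorem cl_put_sub :
    (m.put j m').cl (.sub i x) = if i = j then m'.cl x else m.cl (.sub i x) := rfl
@[simp] theorem qu_put_sub :
    (m.put j m').qu (.sub i r) = if i = j then m'.qu r else m.qu (.sub i r) := rfl

theorem mapQ_id : m.mapQ id = m := by ext <;> simp

theorem mapQ_setQ (σ : ℕ → ℕ) : (m.setQ r l).mapQ σ = (m.mapQ σ).setQ r (l.map σ) := by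
  ext s : 1
  · simp
  · simp only [qu_mapQ, qu_setQ]
    split_ifs <;> rfl

theorem pull_put : (m.put j m').pull j = m' := by ext <;> simp

theorem put_pull : m.put j (m.pull j) = m := by
  ext z : 1 <;> cases z <;> simp +contextual

theorem put_put : (m.put j m').put j m'' = m.put j m'' := by
  ext z : 1 <;> cases z <;> simp +contextual

theorem put_setC : m.put j (m'.setC x w) = (m.put j m').setC (.sub j x) w := by
  ext z : 1 <;> cases z <;> simp [ite_and]
  split_ifs <;> rfl

theorem put_setQ : m.put j (m'.setQ r l) = (m.put j m').setQ (.sub j r) l := by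
  ext z : 1 <;> cases z <;> simp [ite_and]
  split_ifs <;> rfl

end Access

theorem mapQ_eq_self {m : Mem} {n : ℕ} (h : m.WF n) (d : ℕ) : m.mapQ (shift n d) = m := by
  ext r : 1
  · rfl
  · exact (List.map_congr_left fun i hi => if_pos (h r i hi)).trans (List.map_id' _)

theorem WF.mono {m : Mem} {n n' : ℕ} (h : m.WF n) (hn : n ≤ n') : m.WF n' :=
  fun r i hi => (h r i hi).trans_le hn

theorem WF.setC {m : Mem} {n : ℕ} (h : m.WF n) (x : Reg) (w : List Bool) : (m.setC x w).WF n := h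

theorem WF.setQ {m : Mem} {n : ℕ} (h : m.WF n) {r : Reg} {l : List ℕ} (hl : ∀ i ∈ l, i < n) :
    (m.setQ r l).WF n := by
  intro s
  rw [qu_setQ]
  split_ifs
  exacts [hl, h s]

theorem WF.load (cs : List (List Bool)) (n : ℕ) : (Mem.load cs []).WF n := by
  intro r
  cases r <;> simp [Mem.load]

theorem Bounded.mono {m : Mem} {n n' : ℕ} (h : m.Bounded n) (hn : n ≤ n') : m.Bounded n' :=
  fun x => ⟨(h x).1.trans hn, (h x).2.trans hn⟩

theorem Bounded.setC {m : Mem} {n : ℕ} (h : m.Bounded n) {x : Reg} {w : List Bool}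
    (hw : w.length ≤ n) : (m.setC x w).Bounded n := by
  intro y
  refine ⟨?_, (h y).2⟩
  rw [cl_setC]
  split_ifs
  exacts [hw, (h y).1]

theorem Bounded.setQ {m : Mem} {n : ℕ} (h : m.Bounded n) {r : Reg} {l : List ℕ}
    (hl : l.length ≤ n) : (m.setQ r l).Bounded n := by
  intro s
  refine ⟨(h s).1, ?_⟩
  rw [qu_setQ]
  split_ifs
  exacts [hl, (h s).2]

end Mem

section Simulation

variable {n d : ℕ} {E : Amp}

/-- Place the results of an execution in a larger laboratory. -/
def EmbedSimulates (n d : ℕ) (E : Amp) (p p' : QComp (Mem × ℕ)) : Prop :=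
  QComp.Simulates (Lab.embed n d E) (fun L => n ≤ L.next) (Prod.map (Mem.mapQ (shift n d)) id) p p'

theorem simulates_gate {g g' : Amp →ₗ[ℂ] Amp}
    (h : ∀ v, g' (embed n d E v) = embed n d E (g v)) :
    QComp.Simulates (Lab.embed n d E) (fun L => n ≤ L.next) id (QComp.gate g) (QComp.gate g') := by
  intro L hL
  simp [QComp.gate, Lab.embed, h, hL]

/-- The invariant `n ≤ L.next` is needed here: only beyond the room do consecutive names stay
consecutive under the shift. -/
theorem simulates_fresh :
    QComp.Simulates (Lab.embed n d E) (fun L => n ≤ L.next) (shift n d) QComp.fresh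
      QComp.fresh := by
  intro L hL
  simp only [QComp.fresh, Lab.embed, List.map_cons, List.map_nil, Prod.map_apply, shift_succ d hL,
    List.mem_singleton, forall_eq, true_and]
  omega

theorem simulates_measure (hE : SupportedInRoom n d E) (i : ℕ) :
    QComp.Simulates (Lab.embed n d E) (fun L => n ≤ L.next) id (QComp.measure i)
      (QComp.measure (shift n d i)) := by
  intro L hL
  simp [QComp.measure, Lab.embed, collapse_embed hE, hL]

theorem simulates_iterate {f : Mem → QComp (Mem × ℕ)}
    (h : ∀ m, EmbedSimulates n d E (f m) (f (m.mapQ (shift n d)))) :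
    ∀ k m, EmbedSimulates n d E (iterate f k m) (iterate f k (m.mapQ (shift n d)))
  | 0, _ => QComp.Simulates.pure rfl
  | k + 1, m => (h m).bind fun r => (simulates_iterate h k r.1).bind fun _ =>
      QComp.Simulates.pure rfl

/-- Gates act only on the qubits they name, and control flow depends on bits and on lengths, never
on the names of qubits. A bystander state and an injective renaming are therefore invisible to a
program. -/
theorem simulates_exec (hE : SupportedInRoom n d E) (c : Cmd) (m : Mem) :
    EmbedSimulates n d E (c.exec m) (c.exec (m.mapQ (shift n d))) := by
  induction c generalizing m with
  | skip | push | pop | clear | prepend | split | xor => exact QComp.Simulates.pure rfl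
  | seq c d hc hd =>
    exact (hc m).bind fun r => (hd r.1).bind fun _ => QComp.Simulates.pure rfl
  | branch x c d e hc hd he =>
    simp only [Cmd.exec, Mem.cl_mapQ]
    split
    exacts [(hc m).bind fun _ => QComp.Simulates.pure rfl,
      (hd m).bind fun _ => QComp.Simulates.pure rfl, (he m).bind fun _ => QComp.Simulates.pure rfl]
  | loop x c hc => exact simulates_iterate hc _ m
  | qloop r c hc =>
    simp only [Cmd.exec, Mem.qu_mapQ, List.length_map]
    exact simulates_iterate hc _ m
  | qnew r =>
    refine simulates_fresh.bind fun i => QComp.Simulates.pure ?_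
    simp [Mem.mapQ_setQ]
  | had r | tee r =>
    simp only [Cmd.exec, Mem.qu_mapQ]
    cases m.qu r with
    | nil => exact QComp.Simulates.pure rfl
    | cons i l =>
      refine (simulates_gate ?_).bind fun _ => QComp.Simulates.pure rfl
      intro v
      first | exact hadamard_embed hE i v | exact tGate_embed hE i v
  | cnot r s =>
    simp only [Cmd.exec, Mem.qu_mapQ]
    cases m.qu r with
    | nil => exact QComp.Simulates.pure rfl
    | cons i l =>
      cases m.qu s with
      | nil => exact QComp.Simulates.pure rfl
      | cons j l' =>
        exact (simulates_gate (cnotGate_embed hE i j)).bind fun _ => QComp.Simulates.pure rfl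
  | qmove r s =>
    simp only [Cmd.exec, Mem.qu_mapQ]
    cases m.qu r with
    | nil => exact QComp.Simulates.pure rfl
    | cons i l =>
      refine QComp.Simulates.pure ?_
      simp only [Prod.map_apply, id_eq, Mem.mapQ_setQ, List.map_cons, ← Mem.qu_mapQ]
  | qappend r s =>
    refine QComp.Simulates.pure ?_
    simp only [Prod.map_apply, id_eq, Mem.mapQ_setQ, List.map_append, ← Mem.qu_mapQ, List.map_nil]
    simp
  | meas r x =>
    simp only [Cmd.exec, Mem.qu_mapQ]
    cases m.qu r with
    | nil => exact QComp.Simulates.pure rfl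
    | cons i l =>
      refine (simulates_measure hE i).bind fun b => QComp.Simulates.pure ?_
      simp only [Prod.map_apply, id_eq, ← Mem.mapQ_setQ]
      rfl

theorem simulates_run (hE : SupportedInRoom n d E) (c : Cmd) (m : Mem) :
    QComp.Simulates (Lab.embed n d E) (fun L => n ≤ L.next) (Mem.mapQ (shift n d)) (c.run m)
      (c.run (m.mapQ (shift n d))) :=
  (simulates_exec hE c m).bind fun _ => QComp.Simulates.pure rfl

end Simulation

/-- Scaling by `p` is the embedding that adds no qubits and has the scalar `√p` as its added state.
-/
theorem QComp.Homogeneous.run (c : Cmd) (m : Mem) : Homogeneous (c.run m) := by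
  intro p _ L _
  have := simulates_run (supportedInRoom_smul_vacuum 0 0 ((√p : ℝ) : ℂ)) c m L (Nat.zero_le _)
  rw [shift_zero_right, Mem.mapQ_id] at this
  have hΦ : Lab.embed 0 0 (((√p : ℝ) : ℂ) • Finsupp.single ∅ 1) = Lab.scale p :=
    funext (Lab.embed_zero_smul_vacuum p)
  have hid : Mem.mapQ id = id := funext Mem.mapQ_id
  rw [hΦ, hid] at this
  exact ⟨this.1, fun _ _ => trivial⟩


/-! # Invariants of executions -/

/-- The states in which only qubits with names below `n` are in use. -/
def usingBelow (n : ℕ) : Submodule ℂ Amp := Finsupp.supported ℂ ℂ {S | ∀ i ∈ S, i < n}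

theorem Lab.wf_iff {L : Lab} : L.WF ↔ L.amp ∈ usingBelow L.next := by
  rw [usingBelow, Finsupp.mem_supported]
  rfl

theorem single_mem_usingBelow {n : ℕ} {S : Finset ℕ} (h : ∀ i ∈ S, i < n) (c : ℂ) :
    Finsupp.single S c ∈ usingBelow n :=
  Finsupp.single_mem_supported ℂ c h

theorem linearCombination_mem_usingBelow {n : ℕ} {g : Finset ℕ → Amp}
    (h : ∀ S, (∀ i ∈ S, i < n) → g S ∈ usingBelow n) {v : Amp} (hv : v ∈ usingBelow n) :
    Finsupp.linearCombination ℂ g v ∈ usingBelow n := by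
  rw [Finsupp.linearCombination_apply]
  exact Submodule.sum_mem _ fun S hS => Submodule.smul_mem _ _ (h S (hv hS))

section Gates

variable {n i : ℕ} {v : Amp}

theorem hadamard_mem_usingBelow (hi : i < n) (hv : v ∈ usingBelow n) :
    hadamard i v ∈ usingBelow n :=
  linearCombination_mem_usingBelow (fun _ hS => Submodule.smul_mem _ _ (Submodule.add_mem _
    (single_mem_usingBelow (fun j hj => hS j (Finset.mem_of_mem_erase hj)) _)
    (single_mem_usingBelow (Finset.forall_mem_insert _ _ _ |>.2 ⟨hi, hS⟩) _))) hv

theorem tGate_mem_usingBelow (i : ℕ) (hv : v ∈ usingBelow n) : tGate i v ∈ usingBelow n :=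
  linearCombination_mem_usingBelow (fun _ hS => single_mem_usingBelow hS _) hv

theorem cnotGate_mem_usingBelow (i : ℕ) {j : ℕ} (hj : j < n) (hv : v ∈ usingBelow n) :
    cnotGate i j v ∈ usingBelow n := by
  refine linearCombination_mem_usingBelow (fun S hS => single_mem_usingBelow ?_ _) hv
  split_ifs
  · intro a ha
    rw [Finset.mem_symmDiff, Finset.mem_singleton] at ha
    rcases ha with ⟨ha, -⟩ | ⟨rfl, -⟩
    exacts [hS a ha, hj]
  · exact hS

theorem collapse_mem_usingBelow (i : ℕ) (b : Bool) (hv : v ∈ usingBelow n) :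
    collapse i b v ∈ usingBelow n := by
  refine linearCombination_mem_usingBelow (fun S hS => ?_) hv
  split_ifs
  · exact single_mem_usingBelow (fun j hj => hS j (Finset.mem_of_mem_erase hj)) _
  · exact Submodule.zero_mem _

end Gates

/-- The state is well-formed, the qubits in the memory are allocated, and so are the first `n`. -/
def WFBranch (n : ℕ) (m : Mem) (L : Lab) : Prop := L.WF ∧ m.WF L.next ∧ n ≤ L.next

theorem iterate_wf {f : Mem → QComp (Mem × ℕ)}
    (h : ∀ m L, L.WF → m.WF L.next → ∀ r ∈ f m L, WFBranch L.next r.1.1 r.2) (k : ℕ) :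
    ∀ m L, L.WF → m.WF L.next → ∀ r ∈ iterate f k m L, WFBranch L.next r.1.1 r.2 := by
  induction k with
  | zero =>
    intro m L hL hm r hr
    rw [iterate, QComp.pure_apply, List.mem_singleton] at hr
    subst hr
    exact ⟨hL, hm, le_rfl⟩
  | succ k ih =>
    intro m L hL hm r hr
    simp only [iterate, QComp.bind_apply, QComp.pure_apply, List.mem_flatMap,
      List.mem_singleton] at hr
    obtain ⟨s, hs, t, ht, rfl⟩ := hr
    obtain ⟨h₁, h₂, h₃⟩ := h m L hL hm s hs
    obtain ⟨h₄, h₅, h₆⟩ := ih _ _ h₁ h₂ t ht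
    exact ⟨h₄, h₅, h₃.trans h₆⟩

/-- Well-formedness guarantees that an unallocated qubit is in `|0⟩`, which makes the random bits
fair, and that the qubits in memory lie below `L.next`, so that a shift there leaves them alone. -/
theorem exec_wf (c : Cmd) : ∀ (m : Mem) (L : Lab), L.WF → m.WF L.next →
    ∀ r ∈ c.exec m L, WFBranch L.next r.1.1 r.2 := by
  induction c with
  | skip | push | pop | clear | prepend | split | xor =>
    intro m L hL hm r hr
    simp only [Cmd.exec, QComp.pure_apply, List.mem_singleton] at hr
    subst hr
    exact ⟨hL, hm, le_rfl⟩
  | seq c d hc hd =>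
    intro m L hL hm r hr
    simp only [Cmd.exec, QComp.bind_apply, QComp.pure_apply, List.mem_flatMap,
      List.mem_singleton] at hr
    obtain ⟨s, hs, t, ht, rfl⟩ := hr
    obtain ⟨h₁, h₂, h₃⟩ := hc m L hL hm s hs
    obtain ⟨h₄, h₅, h₆⟩ := hd _ _ h₁ h₂ t ht
    exact ⟨h₄, h₅, h₃.trans h₆⟩
  | branch x c d e hc hd he =>
    intro m L hL hm r hr
    rcases hx : m.cl x with _ | ⟨_ | _, w⟩ <;>
    · simp only [Cmd.exec, hx, QComp.bind_apply, QComp.pure_apply, List.mem_flatMap,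
        List.mem_singleton] at hr
      obtain ⟨s, hs, rfl⟩ := hr
      replace hc := hc m L hL hm s
      replace hd := hd m L hL hm s
      replace he := he m L hL hm s
      tauto
  | loop x c hc => intro m; exact iterate_wf hc _ m
  | qloop x c hc => intro m; exact iterate_wf hc _ m
  | qnew r =>
    intro m L hL hm s hs
    simp only [Cmd.exec, QComp.fresh, QComp.bind_apply, QComp.pure_apply, List.flatMap_cons,
      List.flatMap_nil, List.append_nil, List.mem_singleton] at hs
    subst hs
    refine ⟨fun S hS i hi => (hL S hS i hi).trans (Nat.lt_succ_self _),
      Mem.WF.setQ (hm.mono (Nat.le_succ _)) ?_, Nat.le_succ _⟩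
    intro i hi
    rcases List.mem_cons.1 hi with rfl | hi
    exacts [Nat.lt_succ_self _, (hm r i hi).trans (Nat.lt_succ_self _)]
  | had r =>
    intro m L hL hm s hs
    rcases heq : m.qu r with _ | ⟨i, l⟩
    · simp only [Cmd.exec, heq, QComp.pure_apply, List.mem_singleton] at hs
      subst hs
      exact ⟨hL, hm, le_rfl⟩
    · simp only [Cmd.exec, heq, QComp.gate, QComp.bind_apply, QComp.pure_apply, List.flatMap_cons,
        List.flatMap_nil, List.append_nil, List.mem_singleton] at hs
      subst hs
      have hi : i < L.next := hm r i (by simp [heq])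
      refine ⟨Lab.wf_iff.2 ?_, hm, le_rfl⟩
      exact hadamard_mem_usingBelow hi (Lab.wf_iff.1 hL)
  | tee r =>
    intro m L hL hm s hs
    rcases heq : m.qu r with _ | ⟨i, l⟩
    · simp only [Cmd.exec, heq, QComp.pure_apply, List.mem_singleton] at hs
      subst hs
      exact ⟨hL, hm, le_rfl⟩
    · simp only [Cmd.exec, heq, QComp.gate, QComp.bind_apply, QComp.pure_apply, List.flatMap_cons,
        List.flatMap_nil, List.append_nil, List.mem_singleton] at hs
      subst hs
      refine ⟨Lab.wf_iff.2 ?_, hm, le_rfl⟩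
      exact tGate_mem_usingBelow i (Lab.wf_iff.1 hL)
  | cnot r r' =>
    intro m L hL hm s hs
    rcases hr : m.qu r with _ | ⟨i, l⟩
    · simp only [Cmd.exec, hr, QComp.pure_apply, List.mem_singleton] at hs
      subst hs
      exact ⟨hL, hm, le_rfl⟩
    rcases heq : m.qu r' with _ | ⟨j, l'⟩
    · simp only [Cmd.exec, hr, heq, QComp.pure_apply, List.mem_singleton] at hs
      subst hs
      exact ⟨hL, hm, le_rfl⟩
    · simp only [Cmd.exec, hr, heq, QComp.gate, QComp.bind_apply, QComp.pure_apply,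
        List.flatMap_cons,
        List.flatMap_nil, List.append_nil, List.mem_singleton] at hs
      subst hs
      have hj : j < L.next := hm r' j (by simp [heq])
      exact ⟨Lab.wf_iff.2 (cnotGate_mem_usingBelow i hj (Lab.wf_iff.1 hL)), hm, le_rfl⟩
  | qmove r r' =>
    intro m L hL hm s hs
    rcases heq : m.qu r with _ | ⟨i, l⟩
    · simp only [Cmd.exec, heq, QComp.pure_apply, List.mem_singleton] at hs
      subst hs
      exact ⟨hL, hm, le_rfl⟩
    · simp only [Cmd.exec, heq, QComp.pure_apply, List.mem_singleton] at hs
      subst hs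
      have hr := hm r
      rw [heq, List.forall_mem_cons] at hr
      have h₁ := hm.setQ (r := r) hr.2
      exact ⟨hL, h₁.setQ (List.forall_mem_cons.2 ⟨hr.1, h₁ r'⟩), le_rfl⟩
  | qappend r r' =>
    intro m L hL hm s hs
    simp only [Cmd.exec, QComp.pure_apply, List.mem_singleton] at hs
    subst hs
    have h₁ := hm.setQ (r := r) (l := []) (by simp)
    exact ⟨hL, h₁.setQ fun i hi => (List.mem_append.1 hi).elim (hm r i) (h₁ r' i), le_rfl⟩
  | meas r x =>
    intro m L hL hm s hs
    rcases heq : m.qu r with _ | ⟨i, l⟩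
    · simp only [Cmd.exec, heq, QComp.pure_apply, List.mem_singleton] at hs
      subst hs
      exact ⟨hL, hm, le_rfl⟩
    · have hr := hm r
      rw [heq, List.forall_mem_cons] at hr
      simp only [Cmd.exec, heq, QComp.measure, QComp.bind_apply, QComp.pure_apply,
        List.flatMap_cons,
        List.flatMap_nil, List.append_nil, List.mem_cons, List.mem_append, List.not_mem_nil,
        or_false] at hs
      rcases hs with rfl | rfl <;>
      exact ⟨Lab.wf_iff.2 (collapse_mem_usingBelow i _ (Lab.wf_iff.1 hL)),
        (hm.setQ hr.2).setC _ _, le_rfl⟩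

/-! # Renamed and classical programs -/

theorem iterate_rename {f g : Mem → QComp (Mem × ℕ)} {j : ℕ}
    (h : ∀ m, g m = Prod.map (m.put j) id <$> f (m.pull j)) (k : ℕ) (m : Mem) :
    iterate g k m = Prod.map (m.put j) id <$> iterate f k (m.pull j) := by
  induction k generalizing m with
  | zero => simp [iterate, Mem.put_pull]
  | succ k ih => simp [iterate, h, ih, Mem.pull_put, Mem.put_put, Prod.map]

/-- A subroutine sees only its own registers, so it runs on the memory cut out by `pull`, and `put`
restores the frame. -/
theorem exec_rename (j : ℕ) (c : Cmd) (m : Mem) :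
    (c.rename (.sub j)).exec m = Prod.map (m.put j) id <$> c.exec (m.pull j) := by
  induction c generalizing m with
  | skip | push | pop | clear | prepend | split | xor =>
    simp [Cmd.exec, Cmd.rename, Mem.put_setC, Mem.put_pull]
  | seq c d hc hd =>
    simp [Cmd.exec, Cmd.rename, hc, hd, Mem.pull_put, Mem.put_put, Prod.map]
  | branch x c d e hc hd he =>
    simp only [Cmd.exec, Cmd.rename, Mem.cl_pull, hc, hd, he]
    split <;> simp
  | loop x c hc => exact iterate_rename hc _ m
  | qloop r c hc => exact iterate_rename hc _ m
  | qnew r => simp [Cmd.exec, Cmd.rename, Mem.put_setQ, Mem.put_pull]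
  | had r | tee r =>
    simp only [Cmd.exec, Cmd.rename, Mem.qu_pull]
    split <;> simp [Mem.put_pull]
  | cnot r s =>
    simp only [Cmd.exec, Cmd.rename, Mem.qu_pull]
    split <;> simp [Mem.put_pull]
  | qmove r s =>
    simp only [Cmd.exec, Cmd.rename, Mem.qu_pull]
    split <;> simp [Mem.put_setQ, Mem.put_pull]
  | qappend r s => simp [Cmd.exec, Cmd.rename, Mem.put_setQ, Mem.put_pull]
  | meas r x =>
    simp only [Cmd.exec, Cmd.rename, Mem.qu_pull]
    split <;> simp [Mem.put_setQ, Mem.put_setC, Mem.put_pull]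

/-- Without quantum instructions there is a single branch, the same in every laboratory. The length
program can then be replaced by its result. -/
theorem Cmd.Classical.exec_eq_pure {c : Cmd} (hc : c.Classical) (m : Mem) :
    ∃ r, c.exec m = pure r := by
  induction c generalizing m with
  | skip | push | pop | clear | prepend | split | xor => exact ⟨_, rfl⟩
  | seq c d hc' hd' =>
    obtain ⟨r, hr⟩ := hc' hc.1 m
    obtain ⟨s, hs⟩ := hd' hc.2 r.1
    exact ⟨_, by simp [Cmd.exec, hr, hs]; rfl⟩
  | branch x c d e hc' hd' he' =>
    simp only [Cmd.exec]
    split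
    · obtain ⟨r, hr⟩ := hc' hc.1 m
      exact ⟨_, by rw [hr, pure_bind]⟩
    · obtain ⟨r, hr⟩ := hd' hc.2.1 m
      exact ⟨_, by rw [hr, pure_bind]⟩
    · obtain ⟨r, hr⟩ := he' hc.2.2 m
      exact ⟨_, by rw [hr, pure_bind]⟩
  | loop x c hc' =>
    rw [Cmd.exec]
    induction (m.cl x).length generalizing m with
    | zero => exact ⟨_, rfl⟩
    | succ k ih =>
      obtain ⟨r, hr⟩ := hc' hc m
      obtain ⟨s, hs⟩ := ih r.1
      exact ⟨_, by simp [iterate, hr, hs]; rfl⟩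
  | qloop | qnew | had | tee | cnot | qmove | qappend | meas => exact hc.elim

/-! # The results of programs -/

theorem run_eq (c : Cmd) (m : Mem) : c.run m = Prod.fst <$> c.exec m := by
  simp [Cmd.run]

theorem run_wf {c : Cmd} {m : Mem} {L : Lab} (hL : L.WF) (hm : m.WF L.next) :
    ∀ r ∈ c.run m L, WFBranch L.next r.1 r.2 := by
  intro r hr
  rw [run_eq, QComp.map_apply, List.mem_map] at hr
  obtain ⟨s, hs, rfl⟩ := hr
  exact exec_wf c m L hL hm s hs

@[simp]
theorem run_rename (j : ℕ) (c : Cmd) (m : Mem) :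
    (c.rename (.sub j)).run m = m.put j <$> c.run (m.pull j) := by
  simp [run_eq, exec_rename]

theorem run_seq (c d : Cmd) (m : Mem) : (Cmd.seq c d).run m = c.run m >>= d.run := by
  simp only [run_eq, Cmd.exec, map_bind, map_pure, bind_map_left]
  exact bind_congr fun r => (run_eq _ _).symm

@[simp]
theorem run_skip (m : Mem) : Cmd.skip.run m = pure m := by simp [Cmd.run, Cmd.exec]

@[simp]
theorem run_block_nil (m : Mem) : (Cmd.block []).run m = pure m := run_skip m

@[simp]
theorem run_block_cons (c : Cmd) (cs : List Cmd) (m : Mem) :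
    (Cmd.block (c :: cs)).run m = c.run m >>= (Cmd.block cs).run := run_seq c _ m

@[simp]
theorem run_push (b : Bool) (x : Reg) (m : Mem) :
    (Cmd.push b x).run m = pure (m.setC x (b :: m.cl x)) := by simp [Cmd.run, Cmd.exec]

@[simp]
theorem run_prepend (x y : Reg) (m : Mem) :
    (Cmd.prepend x y).run m = pure (m.setC y (m.cl x ++ m.cl y)) := by simp [Cmd.run, Cmd.exec]

@[simp]
theorem run_split (u x y : Reg) (m : Mem) : (Cmd.split u x y).run m =
    pure ((m.setC x ((m.cl x).drop (m.cl u).length)).setC y ((m.cl x).take (m.cl u).length)) := by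
  simp [Cmd.run, Cmd.exec]

@[simp]
theorem run_xor (x y : Reg) (m : Mem) :
    (Cmd.xor x y).run m = pure (m.setC y (xorBits (m.cl x) (m.cl y))) := by
  simp [Cmd.run, Cmd.exec]

@[simp]
theorem run_qappend (r s : Reg) (m : Mem) : (Cmd.qappend r s).run m =
    pure ((m.setQ r []).setQ s (m.qu r ++ (m.setQ r []).qu s)) := by
  simp [Cmd.run, Cmd.exec]

theorem Mem.setC_setC (m : Mem) (x : Reg) (v w : List Bool) :
    (m.setC x v).setC x w = m.setC x w := by
  simp [Mem.setC]

@[simp]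
theorem run_copy {x y : Reg} (h : x ≠ y) (m : Mem) :
    (Cmd.copy x y).run m = pure (m.setC y (m.cl x)) := by
  rw [Cmd.copy, run_seq, Cmd.run, Cmd.exec]
  simp [run_prepend, h, Mem.setC_setC]

/-- Repeat a program `k` times. -/
def runTimes (c : Cmd) : ℕ → Mem → QComp Mem
  | 0, m => pure m
  | k + 1, m => c.run m >>= runTimes c k

@[simp]
theorem run_loop (x : Reg) (c : Cmd) (m : Mem) :
    (Cmd.loop x c).run m = runTimes c (m.cl x).length m := by
  rw [run_eq, Cmd.exec]
  induction (m.cl x).length generalizing m with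
  | zero => simp [iterate, runTimes]
  | succ k ih =>
    simp only [iterate, runTimes, run_eq, map_bind, map_pure, bind_map_left, ← ih]
    simp only [bind_pure_comp]


/-! # Polynomial time -/

/-- Each step enlarges the registers by at most one. -/
def GrowsSlowly (f : Mem → QComp (Mem × ℕ)) : Prop :=
  ∀ m L n, m.Bounded n → ∀ r ∈ f m L, r.1.1.Bounded (n + r.1.2)

theorem growsSlowly_iterate {f : Mem → QComp (Mem × ℕ)} (h : GrowsSlowly f) (k : ℕ) :
    GrowsSlowly (iterate f k) := by
  induction k with
  | zero =>
    intro m L n hm r hr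
    rw [iterate, QComp.pure_apply, List.mem_singleton] at hr
    subst hr
    exact hm.mono (Nat.le_add_right _ _)
  | succ k ih =>
    intro m L n hm r hr
    simp only [iterate, QComp.bind_apply, QComp.pure_apply, List.mem_flatMap,
      List.mem_singleton] at hr
    obtain ⟨s, hs, t, ht, rfl⟩ := hr
    exact (ih _ _ _ (h m L n hm s hs) t ht).mono (by simp only; omega)

theorem xorBits_length : ∀ x y : List Bool, (xorBits x y).length = y.length
  | _, [] => by simp [xorBits]
  | [], b :: y => by simp [xorBits]
  | a :: x, b :: y => by simp [xorBits, xorBits_length x y]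

/-- String instructions are charged the length they handle, so even a concatenation lengthens a
register by no more than its cost. -/
theorem growsSlowly_exec (c : Cmd) : GrowsSlowly c.exec := by
  induction c with
  | skip | pop | clear =>
    intro m L n hm s hs
    simp only [Cmd.exec, QComp.pure_apply, List.mem_singleton] at hs
    subst hs
    have := fun x => (hm x).1
    first
    | exact hm.mono (Nat.le_succ _)
    | exact (hm.mono (Nat.le_succ _)).setC (by grind)
  | push b x =>
    intro m L n hm s hs
    simp only [Cmd.exec, QComp.pure_apply, List.mem_singleton] at hs
    subst hs
    exact (hm.mono (Nat.le_succ _)).setC (Nat.succ_le_succ (hm x).1)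
  | prepend x y =>
    intro m L n hm s hs
    simp only [Cmd.exec, QComp.pure_apply, List.mem_singleton] at hs
    subst hs
    refine (hm.mono (Nat.le_add_right _ _)).setC ?_
    have := (hm y).1
    simp only [List.length_append]
    omega
  | split u x y =>
    intro m L n hm s hs
    simp only [Cmd.exec, QComp.pure_apply, List.mem_singleton] at hs
    subst hs
    have := (hm x).1
    exact ((hm.mono (Nat.le_add_right _ _)).setC (by rw [List.length_drop]; omega)).setC
      (by rw [List.length_take]; omega)
  | xor x y =>
    intro m L n hm s hs
    simp only [Cmd.exec, QComp.pure_apply, List.mem_singleton] at hs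
    subst hs
    have := (hm y).1
    exact (hm.mono (Nat.le_add_right _ _)).setC (by rw [xorBits_length]; omega)
  | seq c d hc hd =>
    intro m L n hm r hr
    simp only [Cmd.exec, QComp.bind_apply, QComp.pure_apply, List.mem_flatMap,
      List.mem_singleton] at hr
    obtain ⟨s, hs, t, ht, rfl⟩ := hr
    exact (hd _ _ _ (hc m L n hm s hs) t ht).mono (by simp only; omega)
  | branch x c d e hc hd he =>
    intro m L n hm r hr
    rcases hx : m.cl x with _ | ⟨_ | _, w⟩ <;>
    · simp only [Cmd.exec, hx, QComp.bind_apply, QComp.pure_apply, List.mem_flatMap,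
        List.mem_singleton] at hr
      obtain ⟨s, hs, rfl⟩ := hr
      refine Mem.Bounded.mono (n := n + s.1.2) ?_ (by simp only; omega)
      replace hc := hc m L n hm s
      replace hd := hd m L n hm s
      replace he := he m L n hm s
      first | exact he hs | exact hd hs | exact hc hs
  | loop x c hc => intro m; exact growsSlowly_iterate hc _ m
  | qloop x c hc => intro m; exact growsSlowly_iterate hc _ m
  | qnew r =>
    intro m L n hm s hs
    simp only [Cmd.exec, QComp.fresh, QComp.bind_apply, QComp.pure_apply, List.flatMap_cons,
      List.flatMap_nil, List.append_nil, List.mem_singleton] at hs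
    subst hs
    exact (hm.mono (Nat.le_succ _)).setQ (Nat.succ_le_succ (hm r).2)
  | had r | tee r =>
    intro m L n hm s hs
    refine Mem.Bounded.mono (n := n) ?_ (Nat.le_add_right _ _)
    rcases heq : m.qu r with _ | ⟨i, l⟩ <;>
    · simp only [Cmd.exec, heq, QComp.gate, QComp.bind_apply, QComp.pure_apply, List.flatMap_cons,
        List.flatMap_nil, List.append_nil, List.mem_singleton] at hs
      subst hs
      exact hm
  | cnot r r' =>
    intro m L n hm s hs
    refine Mem.Bounded.mono (n := n) ?_ (Nat.le_add_right _ _)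
    rcases heq : m.qu r with _ | ⟨i, l⟩ <;> rcases heq' : m.qu r' with _ | ⟨i', l'⟩ <;>
    · simp only [Cmd.exec, heq, heq', QComp.gate, QComp.bind_apply, QComp.pure_apply,
        List.flatMap_cons, List.flatMap_nil, List.append_nil, List.mem_singleton] at hs
      subst hs
      exact hm
  | qmove r r' =>
    intro m L n hm s hs
    rcases heq : m.qu r with _ | ⟨i, l⟩
    · simp only [Cmd.exec, heq, QComp.pure_apply, List.mem_singleton] at hs
      subst hs
      exact hm.mono (Nat.le_succ _)
    · simp only [Cmd.exec, heq, QComp.pure_apply, List.mem_singleton] at hs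
      subst hs
      have hl := (hm r).2
      rw [heq, List.length_cons] at hl
      have h₁ := hm.setQ (r := r) (l := l) (by omega)
      exact (h₁.mono (Nat.le_succ _)).setQ (Nat.succ_le_succ (h₁ r').2)
  | qappend r r' =>
    intro m L n hm s hs
    simp only [Cmd.exec, QComp.pure_apply, List.mem_singleton] at hs
    subst hs
    have h₁ := hm.setQ (r := r) (l := []) (by simp)
    refine (h₁.mono (Nat.le_add_right _ _)).setQ ?_
    have := (h₁ r').2
    simp only [List.length_append]
    omega
  | meas r x =>
    intro m L n hm s hs
    rcases heq : m.qu r with _ | ⟨i, l⟩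
    · simp only [Cmd.exec, heq, QComp.pure_apply, List.mem_singleton] at hs
      subst hs
      exact hm.mono (Nat.le_succ _)
    · have hl := (hm r).2
      rw [heq, List.length_cons] at hl
      simp only [Cmd.exec, heq, QComp.measure, QComp.bind_apply, QComp.pure_apply,
        List.flatMap_cons, List.flatMap_nil, List.append_nil, List.mem_cons, List.mem_append,
        List.not_mem_nil, or_false] at hs
      rcases hs with rfl | rfl <;>
      exact ((hm.setQ (by omega)).mono (Nat.le_succ _)).setC (Nat.succ_le_succ (hm x).1)

theorem PolyTime.seq {c d : Cmd} (hc : PolyTime c) (hd : PolyTime d) : PolyTime (.seq c d) := by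
  obtain ⟨p, hp⟩ := hc
  obtain ⟨q, hq⟩ := hd
  -- After `p(n)` steps the registers have length at most `n + p(n)`, which is the input size for
  -- `d`.
  refine ⟨p + q.comp (.X + p), fun n m L hm r hr => ?_⟩
  simp only [Cmd.exec, QComp.bind_apply, QComp.pure_apply, List.mem_flatMap,
    List.mem_singleton] at hr
  obtain ⟨s, hs, t, ht, rfl⟩ := hr
  have h₁ := hp n m L hm s hs
  have h₂ := hq (n + p.eval n) _ _
    ((growsSlowly_exec c m L n hm s hs).mono (Nat.add_le_add_left h₁ n)) t ht
  simpa using Nat.add_le_add h₁ h₂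

theorem polyTime_skip : PolyTime .skip := by
  refine ⟨1, fun n m L hm r hr => ?_⟩
  simp only [Cmd.exec, QComp.pure_apply, List.mem_singleton] at hr
  simp [hr]

theorem PolyTime.block {cs : List Cmd} (h : ∀ c ∈ cs, PolyTime c) : PolyTime (.block cs) := by
  induction cs with
  | nil => exact polyTime_skip
  | cons c cs ih =>
    rw [List.forall_mem_cons] at h
    exact h.1.seq (ih h.2)

theorem polyTime_push (b : Bool) (x : Reg) : PolyTime (.push b x) := by
  refine ⟨1, fun n m L hm r hr => ?_⟩
  simp only [Cmd.exec, QComp.pure_apply, List.mem_singleton] at hr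
  simp [hr]

theorem polyTime_clear (x : Reg) : PolyTime (.clear x) := by
  refine ⟨1, fun n m L hm r hr => ?_⟩
  simp only [Cmd.exec, QComp.pure_apply, List.mem_singleton] at hr
  simp [hr]

theorem polyTime_prepend (x y : Reg) : PolyTime (.prepend x y) := by
  refine ⟨.X + 1, fun n m L hm r hr => ?_⟩
  simp only [Cmd.exec, QComp.pure_apply, List.mem_singleton] at hr
  simpa [hr] using (hm x).1

theorem polyTime_split (u x y : Reg) : PolyTime (.split u x y) := by
  refine ⟨.X + 1, fun n m L hm r hr => ?_⟩
  simp only [Cmd.exec, QComp.pure_apply, List.mem_singleton] at hr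
  simpa [hr] using (hm u).1

theorem polyTime_xor (x y : Reg) : PolyTime (.xor x y) := by
  refine ⟨.X + 1, fun n m L hm r hr => ?_⟩
  simp only [Cmd.exec, QComp.pure_apply, List.mem_singleton] at hr
  simpa [hr] using (hm y).1

theorem polyTime_qappend (r s : Reg) : PolyTime (.qappend r s) := by
  refine ⟨.X + 1, fun n m L hm t ht => ?_⟩
  simp only [Cmd.exec, QComp.pure_apply, List.mem_singleton] at ht
  simpa [ht] using (hm r).2

theorem polyTime_copy (x y : Reg) : PolyTime (.copy x y) :=
  (polyTime_clear y).seq (polyTime_prepend x y)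

theorem PolyTime.rename {c : Cmd} (h : PolyTime c) (j : ℕ) : PolyTime (c.rename (.sub j)) := by
  obtain ⟨p, hp⟩ := h
  refine ⟨p, fun n m L hm r hr => ?_⟩
  rw [exec_rename, QComp.map_apply, List.mem_map] at hr
  obtain ⟨s, hs, rfl⟩ := hr
  exact hp n _ L (fun x => hm (.sub j x)) s hs

/-- A polynomial-time body is not enough, since repeatedly prepending a register to itself doubles
it each round. The invariant `I` keeps one bound on the cost of a round valid in all rounds. -/
theorem PolyTime.loop {x : Reg} {c : Cmd} (I : ℕ → Mem → Prop) (p : ℕ[X])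
    (hI : ∀ n m, m.Bounded n → I n m)
    (h : ∀ n m L, I n m → ∀ r ∈ c.exec m L, I n r.1.1 ∧ r.1.2 ≤ p.eval n) :
    PolyTime (.loop x c) := by
  have key : ∀ n k m L, I n m → ∀ r ∈ iterate c.exec k m L, r.1.2 ≤ k * (p.eval n + 1) + 1 := by
    intro n k
    induction k with
    | zero =>
      intro m L hm r hr
      rw [iterate, QComp.pure_apply, List.mem_singleton] at hr
      simp [hr]
    | succ k ih =>
      intro m L hm r hr
      simp only [iterate, QComp.bind_apply, QComp.pure_apply, List.mem_flatMap,
        List.mem_singleton] at hr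
      obtain ⟨s, hs, t, ht, rfl⟩ := hr
      obtain ⟨h₁, h₂⟩ := h n m L hm s hs
      have h₃ := ih _ _ h₁ t ht
      simp only
      rw [Nat.succ_mul]
      omega
  -- At most `n` rounds, each with one test of the counter, and the final test.
  refine ⟨.X * (p + 1) + 1, fun n m L hm r hr => (key n _ m L (hI n m hm) r hr).trans ?_⟩
  simp only [Polynomial.eval_add, Polynomial.eval_mul, Polynomial.eval_X, Polynomial.eval_one]
  gcongr
  exact (hm x).1

/-- The program halts within `t` steps. -/
def HaltsWithin (t : ℕ) (c : Cmd) : Prop := ∀ m L, ∀ r ∈ c.exec m L, r.1.2 ≤ t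

theorem HaltsWithin.polyTime_loop {t : ℕ} {c : Cmd} (h : HaltsWithin t c) (x : Reg) :
    PolyTime (.loop x c) :=
  PolyTime.loop (fun _ _ => True) (.C t) (fun _ _ _ => trivial) fun n m L _ r hr =>
    ⟨trivial, by simpa using h m L r hr⟩

theorem HaltsWithin.seq {s t : ℕ} {c d : Cmd} (hc : HaltsWithin s c) (hd : HaltsWithin t d) :
    HaltsWithin (s + t) (.seq c d) := by
  intro m L r hr
  simp only [Cmd.exec, QComp.bind_apply, QComp.pure_apply, List.mem_flatMap,
    List.mem_singleton] at hr
  obtain ⟨u, hu, v, hv, rfl⟩ := hr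
  exact Nat.add_le_add (hc m L u hu) (hd _ _ v hv)

theorem haltsWithin_skip : HaltsWithin 1 .skip := by
  intro m L s hs
  simp only [Cmd.exec, QComp.pure_apply, List.mem_singleton] at hs
  simp [hs]

theorem haltsWithin_push (b : Bool) (x : Reg) : HaltsWithin 1 (.push b x) := by
  intro m L s hs
  simp only [Cmd.exec, QComp.pure_apply, List.mem_singleton] at hs
  simp [hs]

theorem haltsWithin_randomBit (x : Reg) : HaltsWithin 4 (.randomBit x) := by
  have h₁ (r : Reg) : HaltsWithin 1 (.qnew r) := by
    intro m L s hs
    simp only [Cmd.exec, QComp.fresh, QComp.bind_apply, QComp.pure_apply, List.flatMap_cons,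
      List.flatMap_nil, List.append_nil, List.mem_singleton] at hs
    simp [hs]
  have h₂ (r : Reg) : HaltsWithin 1 (.had r) := by
    intro m L s hs
    rcases heq : m.qu r with _ | ⟨i, l⟩ <;>
    · simp only [Cmd.exec, heq, QComp.gate, QComp.bind_apply, QComp.pure_apply, List.flatMap_cons,
        List.flatMap_nil, List.append_nil, List.mem_singleton] at hs
      simp [hs]
  have h₃ (r x : Reg) : HaltsWithin 1 (.meas r x) := by
    intro m L s hs
    rcases heq : m.qu r with _ | ⟨i, l⟩ <;>
    · simp only [Cmd.exec, heq, QComp.measure, QComp.bind_apply, QComp.pure_apply,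
        List.flatMap_cons, List.flatMap_nil, List.append_nil, List.mem_cons, List.mem_append,
        List.not_mem_nil, or_false] at hs
      rcases hs with rfl | rfl <;> rfl
  exact (h₁ _).seq ((h₂ _).seq ((h₃ _ _).seq haltsWithin_skip))

/-- The targets `a` and `b` grow, but the cost of a round depends only on the sources `x` and `y`,
which the body leaves unchanged. -/
theorem polyTime_loop_prepend {x y a b : Reg} (hxa : x ≠ a) (hxb : x ≠ b) (hya : y ≠ a)
    (hyb : y ≠ b) (u : Reg) : PolyTime (.loop u (.block [.prepend x a, .prepend y b])) := by
  refine PolyTime.loop (fun n m => (m.cl x).length ≤ n ∧ (m.cl y).length ≤ n) (2 * .X + 3)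
    (fun n m hm => ⟨(hm x).1, (hm y).1⟩) fun n m L hm r hr => ?_
  simp only [Cmd.block, Cmd.exec, pure_bind, QComp.pure_apply, List.mem_singleton] at hr
  subst hr
  simp [hxa, hxb, hya, hyb]
  omega


/-! # Random bits -/

/-- Skip `d` qubit names. -/
def Lab.bump (d : ℕ) (L : Lab) : Lab := ⟨L.amp, L.next + d⟩

theorem Lab.WF.bump {L : Lab} (h : L.WF) (d : ℕ) : (L.bump d).WF :=
  fun S hS i hi => (h S hS i hi).trans_le (Nat.le_add_right _ _)

theorem Lab.WF.scale {L : Lab} (h : L.WF) (c : ℝ) : (L.scale c).WF :=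
  fun S hS => h S (Finsupp.support_smul hS)

/-- A fresh qubit is in `|0⟩`, so the sign of the Hadamard gate never occurs, and both outcomes have
the same amplitude. As `collapse` resets the measured qubit, the old state reappears up to the
factor. -/
theorem collapse_hadamard {i : ℕ} {v : Amp} (hv : v ∈ usingBelow i) (b : Bool) :
    collapse i b (hadamard i v) = ((√(1 / 2) : ℝ) : ℂ) • v := by
  rw [usingBelow, Finsupp.supported_eq_span_single] at hv
  refine LinearMap.eqOn_span (f := collapse i b ∘ₗ hadamard i)
    (g := ((√(1 / 2) : ℝ) : ℂ) • LinearMap.id) ?_ hv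
  rintro _ ⟨S, hS, rfl⟩
  have hi : i ∉ S := fun h => (hS i h).false
  cases b <;> simp [hadamard, collapse, hi]

theorem foldl_setC_cons (x : Reg) (w : List Bool) (m : Mem) :
    w.foldl (fun m b => m.setC x (b :: m.cl x)) m = m.setC x (w.reverse ++ m.cl x) := by
  induction w generalizing m with
  | nil => ext x : 1 <;> simp +contextual
  | cons b w ih => simp [ih, Mem.setC_setC]

/-- On a well-formed state, the program tosses a fair coin and lets it decide about the memory. -/
def TossesCoin (c : Cmd) (T : Mem → Bool → Mem) : Prop :=
  ∀ m L, L.WF → c.run m L =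
    [(T m false, (L.bump 1).scale (1 / 2)), (T m true, (L.bump 1).scale (1 / 2))]

theorem tossesCoin_randomBit (x : Reg) :
    TossesCoin (.randomBit x) fun m b => m.setC x (b :: m.cl x) := by
  intro m L hL
  have hm : (m.setQ (.main 0) (L.next :: m.qu (.main 0))).setQ (.main 0) (m.qu (.main 0)) = m := by
    ext r : 1 <;> simp +contextual
  have hc := collapse_hadamard (Lab.wf_iff.1 hL)
  simp [Cmd.randomBit, Cmd.block, Cmd.run, Cmd.exec, QComp.bind_apply, QComp.map_apply,
    QComp.pure_apply, QComp.fresh, QComp.gate, QComp.measure, hc, hm, Lab.bump, Lab.scale]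

namespace QComp

/-- Each toss halves the weight and uses up one qubit name; the names used remain visible as `L.bump
k`. -/
theorem expect_runTimes {c : Cmd} {T : Mem → Bool → Mem} (hc : TossesCoin c T)
    {G : Mem → Lab → ℝ} (hG : ∀ c, 0 ≤ c → ∀ a L, G a (L.scale c) = c * G a L) (k : ℕ) (m : Mem)
    {L : Lab} (hL : L.WF) :
    expect (runTimes c k m) G L = average k fun w => G (w.foldl T m) (L.bump k) := by
  induction k generalizing m L with
  | zero => simp [runTimes, average, Lab.bump]
  | succ k ih =>
    have hL' : ((L.bump 1).scale (1 / 2)).WF := (hL.bump 1).scale _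
    have hb : ((L.bump 1).scale (1 / 2)).bump k = (L.bump (k + 1)).scale (1 / 2) := by
      simp only [Lab.bump, Lab.scale, Nat.add_assoc, Nat.add_comm 1 k]
    rw [runTimes, expect_bind, expect, hc m L hL]
    simp only [List.map_cons, List.map_nil, List.sum_cons, List.sum_nil, add_zero, average,
      ih _ hL', hb, hG (1 / 2) (by norm_num), average_mul_left, List.foldl_cons]

theorem average_reverse (k : ℕ) (f : List Bool → ℝ) :
    average k (fun w => f w.reverse) = average k f := by
  induction k generalizing f with
  | zero => rfl
  | succ k ih =>
    rw [average_append_singleton]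
    simp only [List.reverse_append, List.reverse_singleton, List.singleton_append, average]
    rw [ih fun w => f (false :: w), ih fun w => f (true :: w)]

theorem weight_scale_mul {c : ℝ} (hc : 0 ≤ c) (L : Lab) (x : ℝ) :
    (L.scale c).weight * x = c * (L.weight * x) := by
  rw [Lab.weight_scale hc, mul_assoc]

/-- The classical results of a program that gets no qubits do not depend on the laboratory. -/
theorem expect_run_classical (c : Cmd) {m : Mem} (hm : m.WF 0) (f : (Reg → List Bool) → ℝ)
    {L : Lab} (hL : L.WF) :
    expect (c.run m) (fun m' L' => L'.weight * f m'.cl) L =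
      L.weight * mean (c.run m) fun m' => f m'.cl := by
  obtain ⟨hE, hvac⟩ := Lab.eq_embed_vacuum hL
  have h := (simulates_run hE c m).expect (G := fun m' L' => L'.weight * f m'.cl)
    (G' := fun m' L' => L'.weight * f m'.cl) (c := L.weight)
    (fun m' L' _ => by
      change _ * f m'.cl = _
      rw [Lab.weight_embed hE, ← Lab.weight_eq_normSq, mul_assoc])
    (L := Lab.vacuum) (Nat.zero_le _)
  rwa [hvac, Mem.mapQ_eq_self hm] at h

theorem mean_bind (p : QComp α) (q : α → QComp β) (f : β → ℝ) :
    mean (p >>= q) f = expect p (fun a => expect (q a) fun b L => L.weight * f b) Lab.vacuum := by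
  rw [mean, expect_bind]

theorem mean_map {α β : Type} (g : α → β) (p : QComp α) (f : β → ℝ) :
    mean (g <$> p) f = mean p fun a => f (g a) := by
  rw [mean, expect_map, mean]

end QComp

/-! ### Register accesses through subroutine frames and loaded memories. -/

namespace Mem

section Pull

variable (m m' : Mem) (x r : Reg) (w : List Bool) (l : List ℕ) (i j : ℕ)

@[simp] theorem pull_setC_main : (m.setC (.main i) w).pull j = m.pull j := by ext <;> simp
@[simp] theorem pull_setQ_main : (m.setQ (.main i) l).pull j = m.pull j := by ext <;> simp

@[simp] theorem pull_setC_sub :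
    (m.setC (.sub i x) w).pull j = if i = j then (m.pull j).setC x w else m.pull j := by
  split_ifs with h <;> ext <;> simp [h, eq_comm (a := j)]

@[simp] theorem pull_setQ_sub :
    (m.setQ (.sub i r) l).pull j = if i = j then (m.pull j).setQ r l else m.pull j := by
  split_ifs with h <;> ext <;> simp [h, eq_comm (a := j)]

@[simp] theorem pull_put' : (m.put i m').pull j = if i = j then m' else m.pull j := by
  split_ifs with h <;> ext <;> simp [h, eq_comm (a := j)]

end Pull

section Load

variable (cs : List (List Bool)) (qs : List (List ℕ)) (a b c d : List Bool) (l : List ℕ) (i j : ℕ)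
  (x : Reg)

@[simp] theorem pull_load : (load cs qs).pull j = load [] [] := by
  ext x : 1 <;> cases x <;> simp [load]

@[simp] theorem cl_load_main : (load cs qs).cl (.main i) = cs.getD i [] := rfl
@[simp] theorem qu_load_main : (load cs qs).qu (.main i) = qs.getD i [] := rfl
@[simp] theorem cl_load_sub : (load cs qs).cl (.sub i x) = [] := rfl
@[simp] theorem qu_load_sub : (load cs qs).qu (.sub i x) = [] := rfl

theorem load_setC_length : (load cs qs).setC (.main cs.length) a = load (cs ++ [a]) qs := by
  ext x : 1
  · cases x with
    | main i =>
      simp only [cl_setC, Reg.main.injEq, cl_load_main]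
      grind
    | sub j r => simp [cl_load_sub]
  · rfl

@[simp] theorem load_setC_zero : (load [] qs).setC (.main 0) a = load [a] qs :=
  load_setC_length [] qs a
@[simp] theorem load_setC_one : (load [a] qs).setC (.main 1) b = load [a, b] qs :=
  load_setC_length [a] qs b
@[simp] theorem load_setC_two : (load [a, b] qs).setC (.main 2) c = load [a, b, c] qs :=
  load_setC_length [a, b] qs c
@[simp] theorem load_setC_three : (load [a, b, c] qs).setC (.main 3) d = load [a, b, c, d] qs :=
  load_setC_length [a, b, c] qs d

@[simp] theorem load_setQ_zero : (load cs []).setQ (.main 0) l = load cs [l] := by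
  ext x : 1
  · rfl
  · rcases x with (_ | i) | ⟨j, r⟩ <;> simp [load]

end Load

end Mem

/-! ### The derived scheme: output distributions, efficiency, correctness. -/

namespace SDE

variable {S : SDE}

theorem IsScheme.run_lenProg (hS : S.IsScheme) (k : ℕ) :
    ∃ m, S.lenProg.run (Mem.load [ones k] []) = pure m ∧
      (m.cl (.main 0)).length = S.msgLen k := by
  obtain ⟨hc, -, hl⟩ := hS.length
  obtain ⟨r, hr⟩ := hc.exec_eq_pure (Mem.load [ones k] [])
  have h : S.lenProg.run (Mem.load [ones k] []) = pure r.1 := by rw [run_eq, hr, map_pure]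
  exact ⟨r.1, h, hl k Lab.vacuum (r.1, Lab.vacuum) (by rw [h]; exact List.mem_singleton_self _)⟩

/-- `ueKeyGen` runs all its subroutines in one laboratory, where earlier ones may leave qubits
behind. As `Enc` is handed only strings, the leftovers contribute nothing but their weight, and
`Enc` may be run in a laboratory of its own, as in the games. -/
theorem mean_runKeyGen (hS : S.IsScheme) (k : ℕ) (f : List Bool × List Bool → ℝ) :
    QComp.mean (S.toUE.runKeyGen k) f = QComp.mean (S.runSetup k) fun pm =>
      QComp.average (S.msgLen k) fun s => QComp.mean (S.runEnc k pm.1 s) fun ct =>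
        f (s ++ pm.2, ct) := by
  obtain ⟨ml, hml, hlen⟩ := hS.run_lenProg k
  simp only [UE.runKeyGen, toUE, ueKeyGen, runSetup, bind_pure_comp, QComp.mean_map]
  simp [hml, hlen]
  rw [QComp.mean_bind, QComp.mean]
  refine QComp.expect_congr fun r hr => ?_
  obtain ⟨hr₁, -, -⟩ := run_wf Lab.WF.vacuum (Mem.WF.load _ _) r hr
  rw [QComp.expect_bind, QComp.expect_runTimes (tossesCoin_randomBit _) _ _ _ hr₁,
    ← QComp.average_mul_left]
  · simp only [foldl_setC_cons]
    -- Pushing the coins one by one reverses their order.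
    rw [← QComp.average_reverse]
    refine QComp.average_congr fun w _ => ?_
    simp [QComp.expect_map, runEnc, QComp.mean_map]
    exact QComp.expect_run_classical S.enc (Mem.WF.load _ _)
      (fun cl => f (w ++ r.1.cl (.main 1), cl (.main 0))) (hr₁.bump _)
  · intro c hc m L
    exact (QComp.Homogeneous.run _ _).expect_scale
      (fun c hc m L => QComp.weight_scale_mul hc L _) hc L

theorem runEnc_toUE (hS : S.IsScheme) (k : ℕ) {s : List Bool} (hs : s.length = S.msgLen k)
    (msk msg : List Bool) : S.toUE.runEnc k (s ++ msk) msg =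
      (fun sk => (xorBits s msg, sk)) <$> S.runKeyGen k msk := by
  obtain ⟨ml, hml, hlen⟩ := hS.run_lenProg k
  simp [UE.runEnc, toUE, ueEnc, runKeyGen, hml, hlen, ← hs]

theorem runDec_toUE (k : ℕ) (dk : List Bool) (ct : List Bool × List ℕ) :
    S.toUE.runDec k dk ct = xorBits ct.1 <$> S.runDec k ct.2 dk := by
  simp [UE.runDec, toUE, ueDec, runDec]

/-- `out` may have any length: `xorBits` keeps the length of its second argument, so for a wrong
length both sides are false. -/
theorem xorBits_cancel {s msg out : List Bool} (h : s.length = msg.length) :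
    xorBits (xorBits s msg) out = msg ↔ out = s := by
  induction s generalizing msg out with
  | nil =>
    obtain rfl : msg = [] := List.length_eq_zero_iff.1 h.symm
    cases out <;> simp [xorBits]
  | cons a s ih =>
    obtain ⟨b, msg, rfl⟩ := List.exists_cons_of_length_eq_add_one h.symm
    cases out with
    | nil => simp [xorBits]
    | cons c out =>
      simp only [List.length_cons, Nat.add_right_cancel_iff] at h
      simp only [xorBits, List.cons.injEq, ih h]
      cases a <;> cases b <;> cases c <;> simp

theorem polyTime_ueKeyGen (hS : S.IsScheme) : PolyTime S.ueKeyGen := by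
  refine PolyTime.block ?_
  simp only [List.forall_mem_cons]
  exact ⟨polyTime_copy _ _, polyTime_copy _ _, polyTime_copy _ _, hS.length.2.1.rename 0,
    hS.setup.rename 1, (haltsWithin_randomBit _).polyTime_loop _, polyTime_copy _ _,
    polyTime_copy _ _, hS.enc.rename 2, polyTime_copy _ _, polyTime_prepend _ _,
    polyTime_copy _ _, by simp⟩

theorem polyTime_ueEnc (hS : S.IsScheme) : PolyTime S.ueEnc := by
  refine PolyTime.block ?_
  simp only [List.forall_mem_cons]
  exact ⟨polyTime_copy _ _, hS.length.2.1.rename 0, polyTime_split _ _ _, polyTime_copy _ _,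
    polyTime_copy _ _, hS.keyGen.rename 1, polyTime_qappend _ _, polyTime_copy _ _,
    polyTime_xor _ _, by simp⟩

theorem polyTime_ueDec (hS : S.IsScheme) : PolyTime S.ueDec := by
  refine PolyTime.block ?_
  simp only [List.forall_mem_cons]
  exact ⟨polyTime_copy _ _, polyTime_copy _ _, polyTime_qappend _ _, hS.dec.rename 0,
    polyTime_copy _ _, polyTime_xor _ _, by simp⟩

theorem homogeneous_runKeyGen (S : SDE) (k : ℕ) (msk : List Bool) :
    (S.runKeyGen k msk).Homogeneous :=
  (QComp.Homogeneous.run _ _).bind fun _ => QComp.Homogeneous.pure _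

theorem homogeneous_runDec (S : SDE) (k : ℕ) (sk : List ℕ) (ct : List Bool) :
    (S.runDec k sk ct).Homogeneous :=
  (QComp.Homogeneous.run _ _).bind fun _ => QComp.Homogeneous.pure _

/-- The probability of correct decryption, as an iterated expectation. -/
theorem prob_correctnessExp (S : SDE) (k : ℕ) (msg : List Bool) :
    (S.correctnessExp k msg).prob = QComp.mean (S.runSetup k) fun pm =>
      QComp.mean (S.runEnc k pm.1 msg) fun ct =>
        QComp.expect (S.runKeyGen k pm.2) (fun sk => QComp.expect (S.runDec k sk ct) fun out =>
          QComp.accept (decide (out = msg))) Lab.vacuum := by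
  have h₁ (sk ct c) (hc : 0 ≤ c) (L : Lab) := (S.homogeneous_runDec k sk ct).expect_scale
    (G := fun out => QComp.accept (decide (out = msg)))
    (fun c hc _ L => QComp.accept_scale hc _ L) hc L
  simp only [QComp.prob_eq_expect, correctnessExp, QComp.expect_bind, bind_pure_comp,
    QComp.expect_map]
  rw [QComp.expect_isolated]
  · refine QComp.mean_congr fun pm => ?_
    rw [← QComp.expect_mean]
    refine QComp.expect_congr fun r _ => ?_
    exact QComp.expect_isolated _ (fun c hc ct L => h₁ _ ct c hc L) _
  · intro c hc pm L
    refine (S.homogeneous_runKeyGen k pm.2).expect_scale (fun c hc sk L => ?_) hc L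
    exact (QComp.Homogeneous.isolated _).expect_scale (fun c hc ct L => h₁ sk ct c hc L) hc L

/-- Unmasking returns `msg` exactly if `Dec` returns `s`, and `s` is a uniformly chosen plaintext of
`S`. -/
theorem prob_correctnessExp_toUE (hS : S.IsScheme) (k : ℕ) {msg : List Bool}
    (hmsg : msg.length = S.msgLen k) : (S.toUE.correctnessExp k msg).prob =
      QComp.average (S.msgLen k) fun s => (S.correctnessExp k s).prob := by
  simp only [QComp.prob_eq_expect, UE.correctnessExp, QComp.expect_bind, bind_pure_comp,
    QComp.expect_map]
  rw [QComp.expect_isolated, mean_runKeyGen hS, QComp.mean_average]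
  · refine QComp.average_congr fun s hs => ?_
    rw [← QComp.prob_eq_expect, prob_correctnessExp]
    refine QComp.mean_congr fun pm => QComp.mean_congr fun ct => ?_
    simp only [runEnc_toUE hS k hs, runDec_toUE, QComp.expect_map,
      xorBits_cancel (hs.trans hmsg.symm)]
  · intro c hc pm L
    refine ((QComp.Homogeneous.run _ _).bind fun _ => QComp.Homogeneous.pure _).expect_scale
      (fun c hc ct L => ?_) hc L
    exact ((QComp.Homogeneous.run _ _).bind fun _ => QComp.Homogeneous.pure _).expect_scale
      (fun c hc _ L => QComp.accept_scale hc _ L) hc L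

theorem isScheme_toUE (hS : S.IsScheme) : S.toUE.IsScheme where
  length := hS.length
  keyGen := polyTime_ueKeyGen hS
  enc := polyTime_ueEnc hS
  dec := polyTime_ueDec hS
  correct := by
    obtain ⟨ν, hν, h⟩ := hS.correct
    refine ⟨ν, hν, fun k msg hmsg => ?_⟩
    rw [prob_correctnessExp_toUE hS k hmsg, ← QComp.average_const (S.msgLen k) (1 - ν k)]
    exact QComp.average_mono fun s hs => h k s hs

end SDE

/-! # The reduction -/

theorem xorBits_self_left {r s : List Bool} (h : r.length = s.length) :
    xorBits r (xorBits r s) = s := by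
  induction r generalizing s with
  | nil => cases s <;> simp [xorBits]
  | cons a r ih =>
    obtain ⟨b, s, rfl⟩ := List.exists_cons_of_length_eq_add_one h.symm
    simp only [List.length_cons, Nat.add_right_cancel_iff] at h
    simp [xorBits, ih h]

theorem xorBits_comm {r s : List Bool} (h : r.length = s.length) :
    xorBits r s = xorBits s r := by
  induction r generalizing s with
  | nil =>
    obtain rfl : s = [] := List.length_eq_zero_iff.1 h.symm
    rfl
  | cons a r ih =>
    obtain ⟨b, s, rfl⟩ := List.exists_cons_of_length_eq_add_one h.symm
    simp only [List.length_cons, Nat.add_right_cancel_iff] at h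
    simp [xorBits, ih h, Bool.xor_comm]

theorem xorBits_eq_iff {r s out : List Bool} (h : r.length = s.length) :
    xorBits r out = s ↔ out = xorBits r s := by
  constructor
  · rintro rfl
    rw [xorBits_self_left]
    rw [h, xorBits_length]
  · rintro rfl
    exact xorBits_self_left h

theorem QComp.Homogeneous.expect_accept_scale {p : QComp Bool} (h : p.Homogeneous) (c : ℝ)
    (hc : 0 ≤ c) (L : Lab) : p.expect accept (L.scale c) = c * p.expect accept L :=
  h.expect_scale (fun _ hc b L => accept_scale hc b L) hc L

theorem QComp.mapM_map {α β ι : Type} (g : α → β) (f : ι → QComp α) (l : List ι) :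
    (l.mapM fun i => g <$> f i) = List.map g <$> l.mapM f := by
  induction l with
  | nil => simp
  | cons i l ih => simp [ih]

theorem QComp.repeatComp_map {α β : Type} (g : α → β) (p : QComp α) (q : ℕ) :
    repeatComp q (g <$> p) = List.map g <$> repeatComp q p :=
  QComp.mapM_map g (fun _ => p) _

/-- On a well-formed state, a process that allocates qubits returns the allocated ones. -/
theorem repeatComp_wf {p : QComp (List ℕ)}
    (hp : ∀ L, L.WF → ∀ r ∈ p L, r.2.WF ∧ (∀ i ∈ r.1, i < r.2.next) ∧ L.next ≤ r.2.next)
    (q : ℕ) {L : Lab} (hL : L.WF) : ∀ r ∈ repeatComp q p L,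
      r.1.length = q ∧ r.2.WF ∧ (∀ i ∈ r.1.flatten, i < r.2.next) ∧ L.next ≤ r.2.next := by
  rw [repeatComp, ← List.length_range (n := q)]
  simp only [List.length_range]
  -- Only the length of the list matters, which makes the induction possible.
  generalize hl : List.range q = l
  have hlen : l.length = q := by rw [← hl, List.length_range]
  clear hl
  induction l generalizing q L with
  | nil =>
    intro r hr
    rw [List.mapM_nil, QComp.pure_apply, List.mem_singleton] at hr
    subst hr
    simpa using ⟨hlen, hL⟩
  | cons a l ih =>
    intro r hr
    rw [List.mapM_cons] at hr
    simp only [QComp.bind_apply, QComp.pure_apply, List.mem_flatMap, List.mem_singleton] at hr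
    obtain ⟨s, hs, t, ht, rfl⟩ := hr
    obtain ⟨h₁, h₂, h₃⟩ := hp L hL s hs
    obtain ⟨h₄, h₅, h₆, h₇⟩ := ih (L := s.2) l.length h₁ rfl t ht
    refine ⟨by simpa [h₄] using hlen, h₅, fun i hi => ?_, h₃.trans h₇⟩
    rw [List.flatten_cons, List.mem_append] at hi
    exact hi.elim (fun hi => (h₂ i hi).trans_le h₇) (h₆ i)

theorem runKeyGen_wf (S : SDE) (k : ℕ) (msk : List Bool) {L : Lab} (hL : L.WF) :
    ∀ r ∈ S.runKeyGen k msk L,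
      r.2.WF ∧ (∀ i ∈ r.1, i < r.2.next) ∧ L.next ≤ r.2.next := by
  intro r hr
  rw [SDE.runKeyGen, bind_pure_comp, QComp.map_apply, List.mem_map] at hr
  obtain ⟨s, hs, rfl⟩ := hr
  obtain ⟨h₁, h₂, h₃⟩ := run_wf hL ((Mem.WF.load _ 0).mono (Nat.zero_le _)) s hs
  exact ⟨h₁, h₂ _, h₃⟩

/-! ### The search game, split into phases. -/

namespace UE

variable (A : Adversary) (k : ℕ)

/-- The guesses, made with the keys `dk` from the registers `R`, all equal `msg`. -/
def guessPhase (z : List Bool) (R : List (List ℕ)) (q : ℕ) (dk msg : List Bool) : QComp Bool := do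
  let outs ← (List.range (q + 1)).mapM fun i => do
    let m ← A.guess.run (Mem.load [ones k, ones (i + 1), z, dk] [R.getD i []])
    return m.cl (.main 0)
  return decide (∀ out ∈ outs, out = msg)

/-- The part of the search game that follows the preparation of the ciphertexts. -/
def clonePhase (m : Mem) (q : ℕ) (dk msg : List Bool) : QComp Bool := do
  let mem ← A.clone.run m
  guessPhase A k (mem.cl (.main 0)) (cutInto (decodeLengths (mem.cl (.main 1))) (mem.qu (.main 0)))
    q dk msg

theorem homogeneous_guessPhase (z : List Bool) (R : List (List ℕ)) (q : ℕ) (dk msg : List Bool) :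
    (guessPhase A k z R q dk msg).Homogeneous :=
  (QComp.Homogeneous.mapM (fun _ => (QComp.Homogeneous.run _ _).bind fun _ =>
    QComp.Homogeneous.pure _) _).bind fun _ => QComp.Homogeneous.pure _

theorem homogeneous_clonePhase (m : Mem) (q : ℕ) (dk msg : List Bool) :
    (clonePhase A k m q dk msg).Homogeneous :=
  (QComp.Homogeneous.run _ _).bind fun _ => homogeneous_guessPhase _ _ _ _ _ _ _

theorem cutInto_map {α β : Type} (f : α → β) (ns : List ℕ) (l : List α) :
    cutInto ns (l.map f) = (cutInto ns l).map (List.map f) := by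
  induction ns generalizing l with
  | nil => rfl
  | cons n ns ih => simp [cutInto, ← List.map_take, ← List.map_drop, ih]

theorem mapQ_load (σ : ℕ → ℕ) (cs : List (List Bool)) (l : List ℕ) :
    (Mem.load cs [l]).mapQ σ = Mem.load cs [l.map σ] := by
  ext r : 1
  · rfl
  · rcases r with (_ | i) | ⟨j, r⟩ <;> simp [Mem.load]

/-- The qubits are distributed among the guessers by lengths recorded in bits, so cutting commutes
with renaming. -/
theorem simulates_clonePhase {n d : ℕ} {E : Amp} (hE : SupportedInRoom n d E) (m : Mem) (q : ℕ)
    (dk msg : List Bool) :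
    QComp.Simulates (Lab.embed n d E) (fun L => n ≤ L.next) id (clonePhase A k m q dk msg)
      (clonePhase A k (m.mapQ (shift n d)) q dk msg) := by
  refine (simulates_run hE A.clone m).bind fun mem => ?_
  refine (QComp.Simulates.mapM (fun i => ?_) _).bind fun _ => QComp.Simulates.pure rfl
  have h : (cutInto (decodeLengths ((mem.mapQ (shift n d)).cl (.main 1)))
      ((mem.mapQ (shift n d)).qu (.main 0))).getD i [] =
      ((cutInto (decodeLengths (mem.cl (.main 1))) (mem.qu (.main 0))).getD i []).map
        (shift n d) := by
    rw [Mem.qu_mapQ, Mem.cl_mapQ, cutInto_map]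
    exact List.getD_map (f := List.map (shift n d)) (d := []) ..
  rw [h, ← mapQ_load]
  exact (simulates_run hE A.guess _).bind fun _ => QComp.Simulates.pure rfl

/-- Skipping names is the embedding that adds `d` qubits in `|0⟩`, of norm one, beyond all qubits in
use. It will absorb the names spent on the pirate's coins. -/
theorem expect_clonePhase_bump {m : Mem} (q : ℕ) (dk msg : List Bool) {L : Lab} (hL : L.WF)
    (hm : m.WF L.next) (d : ℕ) :
    (clonePhase A k m q dk msg).expect QComp.accept (L.bump d) =
      (clonePhase A k m q dk msg).expect QComp.accept L := by
  have hE : SupportedInRoom L.next d (Finsupp.single ∅ 1) := by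
    simpa using supportedInRoom_smul_vacuum L.next d 1
  have hn : normSq (Finsupp.single ∅ 1) = 1 := by simpa using normSq_smul_vacuum 1
  have h := (simulates_clonePhase A k hE m q dk msg).expect (G := QComp.accept)
    (G' := QComp.accept) (c := 1) (fun b L' _ => by
      cases b <;> simp [QComp.accept, Lab.weight_embed hE, hn]) (L := L) le_rfl
  rwa [hL.embed_vacuum, Mem.mapQ_eq_self hm, one_mul] at h

/-- The part of the search game that follows the choice of the message. -/
def challengePhase (U : UE) (m : Mem) (ek dk msg : List Bool) : QComp Bool := do
  let cts ← repeatComp (m.cl (.main 0)).length (U.runEnc k ek msg)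
  clonePhase A k
    ((((m.setC (.main 0) (encodeLengths (cts.map fun ct => ct.2.length))).setC
      (.main 1) (cts.map fun ct => ct.1).flatten).setC
      (.main 2) (encodeLengths (cts.map fun ct => ct.1.length))).setQ
      (.main 0) (cts.map fun ct => ct.2).flatten) (m.cl (.main 0)).length dk msg

/-- The part of the search game that follows the generation of the keys. -/
def attackPhase (U : UE) (keys : List Bool × List Bool) : QComp Bool := do
  let m ← A.query.run (Mem.load [ones k] [])
  let msg ← QComp.uniformBits (U.msgLen k)
  challengePhase A k U m keys.1 keys.2 msg

theorem searchGame_eq (U : UE) :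
    U.searchGame A k = (U.runKeyGen k).isolated >>= attackPhase A k U := rfl

theorem homogeneous_challengePhase (U : UE) (m : Mem) (ek dk msg : List Bool) :
    (challengePhase A k U m ek dk msg).Homogeneous :=
  (QComp.Homogeneous.repeatComp ((QComp.Homogeneous.run _ _).bind fun _ =>
    QComp.Homogeneous.pure _) _).bind fun _ => homogeneous_clonePhase _ _ _ _ _ _

theorem homogeneous_attackPhase (U : UE) (keys : List Bool × List Bool) :
    (attackPhase A k U keys).Homogeneous :=
  (QComp.Homogeneous.run _ _).bind fun _ => (QComp.Homogeneous.uniformBits _).bind fun _ =>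
    homogeneous_challengePhase _ _ _ _ _ _ _

/-- The memory on which the second stage of the adversary starts: `m` is left by the first stage,
and there is a ciphertext `(sk, r)` for each `sk` in `sks`. -/
def cloneInput (m : Mem) (sks : List (List ℕ)) (r : List Bool) : Mem :=
  (((m.setC (.main 0) (encodeLengths (sks.map List.length))).setC
    (.main 1) (sks.map fun _ => r).flatten).setC
    (.main 2) (encodeLengths (sks.map fun _ => r.length))).setQ
    (.main 0) sks.flatten

theorem cloneInput_wf {m : Mem} {sks : List (List ℕ)} (r : List Bool) {n : ℕ} (hm : m.WF n)
    (h : ∀ i ∈ sks.flatten, i < n) : (cloneInput m sks r).WF n :=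
  Mem.WF.setQ (m := ((m.setC _ _).setC _ _).setC _ _) hm h

end UE

namespace SDE

open UE QComp

variable {S : SDE} (A : UE.Adversary) (k : ℕ)

/-- The average runs over the mask `r` in place of the message: what the cloner receives no longer
depends on `s`, which survives only in `ct` and in the target `s ⊕ r`. -/
theorem prob_searchGame (hS : S.IsScheme) : (S.toUE.searchGame A k).prob =
    mean (S.runSetup k) fun pm => average (S.msgLen k) fun s => mean (S.runEnc k pm.1 s) fun ct =>
      expect (A.query.run (Mem.load [ones k] [])) (fun m L => average (S.msgLen k) fun r =>
        expect (repeatComp (m.cl (.main 0)).length (S.runKeyGen k pm.2)) (fun sks =>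
          expect (clonePhase A k (cloneInput m sks r) (m.cl (.main 0)).length ct (xorBits s r))
            accept) L) Lab.vacuum := by
  rw [prob_eq_expect, searchGame_eq, expect_bind,
    expect_isolated _ fun c hc a L => (homogeneous_attackPhase A k _ a).expect_accept_scale c hc L,
    mean_runKeyGen hS]
  refine mean_congr fun pm => average_congr fun s hs => mean_congr fun ct => ?_
  rw [attackPhase, expect_bind]
  refine expect_congr fun r _ => ?_
  rw [expect_bind, expect_uniformBits _ fun c hc msg L =>
    (homogeneous_challengePhase A k _ _ _ _ msg).expect_accept_scale c hc L,
    -- Substitute `msg = s ⊕ r`; the mask `s ⊕ msg` then becomes `r`.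
    ← average_xorBits _ hs]
  refine average_congr fun w hw => ?_
  have h : xorBits s (xorBits s w) = w := xorBits_self_left (hs.trans hw.symm)
  simp only [challengePhase, runEnc_toUE hS k hs, h, repeatComp_map, expect_bind, expect_map,
    List.map_map, cloneInput, Function.comp_def, List.map_id']

end SDE

/-- All masks have the same length, so the pirate obtains their length encoding by repeating the
block `1^ℓ 0`. -/
theorem encodeLengths_replicate (q n : ℕ) :
    encodeLengths (List.replicate q n) = (List.replicate q (ones n ++ [false])).flatten := by
  induction q with
  | zero => rfl
  | succ q ih => simp [List.replicate_succ, encodeLengths, ih]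

theorem runTimes_prepend {x y a b : Reg} (hxa : x ≠ a) (hxb : x ≠ b) (hya : y ≠ a)
    (hyb : y ≠ b) (hab : a ≠ b) (q : ℕ) (m : Mem) :
    runTimes (.block [.prepend x a, .prepend y b]) q m =
      pure ((m.setC a ((List.replicate q (m.cl x)).flatten ++ m.cl a)).setC b
        ((List.replicate q (m.cl y)).flatten ++ m.cl b)) := by
  induction q generalizing m with
  | zero =>
    have h : (m.setC a (m.cl a)).setC b (m.cl b) = m := by simp [Mem.setC]
    simp [runTimes, h]
  | succ q ih =>
    simp only [runTimes, run_block_cons, run_prepend, run_block_nil, pure_bind, ih]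
    congr 1
    ext z : 1
    · simp only [Mem.cl_setC, hxa, hxb, hya, hyb, hab, hab.symm, if_false, if_true]
      split_ifs <;> simp [List.replicate_succ', List.append_assoc]
    · rfl

theorem Mem.setQ_setQ (m : Mem) (r : Reg) (l l' : List ℕ) :
    (m.setQ r l).setQ r l' = m.setQ r l' := by
  simp [Mem.setQ]

/-! ### The pirate and its winning probability. -/

namespace SDE

open UE QComp

variable {S : SDE}

/-- The first stage of the pirate: run the first stage of the cloner. -/
def pirateQuery (A : UE.Adversary) : Cmd :=
  .block [
    .copy (.main 0) (.sub 0 (.main 0)),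
    -- `1^k` is set aside for the length program of the second stage, because `main 0` will be
    -- overwritten.
    .copy (.main 0) (.sub 1 (.main 0)),
    A.query.rename (.sub 0),
    .copy (.sub 0 (.main 0)) (.main 0)]

/-- The second stage of the pirate: pair the keys with a random string `r` and run the second stage
of the cloner on them. The string `r` is made a part of the description of the decryptors. -/
def pirateClone (S : SDE) (A : UE.Adversary) : Cmd :=
  .block [
    S.lenProg.rename (.sub 1),
    -- The end marker of the block `1^ℓ 0` in `main 3`. The next loop puts `r` into `main 2` and
    -- `1^ℓ` in front of the marker; the one after it runs `q` times, as `sub 0 (main 0)` still has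
    -- the length chosen by the cloner.
    .push false (.main 3),
    .loop (.sub 1 (.main 0)) (.block [.randomBit (.main 2), .push true (.main 3)]),
    .loop (.sub 0 (.main 0)) (.block [.prepend (.main 2) (.main 4), .prepend (.main 3) (.main 5)]),
    -- The search game overwrites this quantum register with the ciphertexts. Qubits that the
    -- cloner's first stage left there are moved out of the way.
    .qappend (.sub 0 (.main 0)) (.main 1),
    .qappend (.main 0) (.sub 0 (.main 0)),
    .copy (.main 0) (.sub 0 (.main 0)),
    .copy (.main 4) (.sub 0 (.main 1)),
    .copy (.main 5) (.sub 0 (.main 2)),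
    A.clone.rename (.sub 0),
    .copy (.sub 0 (.main 0)) (.main 0),
    .prepend (.main 2) (.main 0),
    .copy (.sub 0 (.main 1)) (.main 1),
    .qappend (.sub 0 (.main 0)) (.main 0)]

/-- The decryptors: guess the message that is encrypted by `r`, and add `r`. -/
def pirateDecrypt (S : SDE) (A : UE.Adversary) : Cmd :=
  .block [
    .copy (.main 0) (.sub 1 (.main 0)),
    S.lenProg.rename (.sub 1),
    .split (.sub 1 (.main 0)) (.main 2) (.main 4),
    .copy (.main 0) (.sub 0 (.main 0)),
    .copy (.main 1) (.sub 0 (.main 1)),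
    .copy (.main 2) (.sub 0 (.main 2)),
    .copy (.main 3) (.sub 0 (.main 3)),
    .qappend (.main 0) (.sub 0 (.main 0)),
    A.guess.rename (.sub 0),
    .copy (.sub 0 (.main 0)) (.main 0),
    .xor (.main 4) (.main 0)]

/-- The pirate that is obtained from a cloner. -/
def pirate (S : SDE) (A : UE.Adversary) : SDE.Adversary where
  query := pirateQuery A
  pirate := S.pirateClone A
  decrypt := S.pirateDecrypt A

theorem qpt_pirate (hS : S.IsScheme) {A : UE.Adversary} (hA : A.QPT) : (S.pirate A).QPT := by
  obtain ⟨hq, hc, hg⟩ := hA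
  have hl := hS.length.2.1.rename 1
  refine ⟨PolyTime.block ?_, PolyTime.block ?_, PolyTime.block ?_⟩ <;>
    simp only [List.forall_mem_cons]
  · exact ⟨polyTime_copy _ _, polyTime_copy _ _, hq.rename 0, polyTime_copy _ _, by simp⟩
  · exact ⟨hl, polyTime_push _ _,
      ((haltsWithin_randomBit _).seq ((haltsWithin_push _ _).seq haltsWithin_skip)).polyTime_loop _,
      polyTime_loop_prepend (by simp) (by simp) (by simp) (by simp) _, polyTime_qappend _ _,
      polyTime_qappend _ _, polyTime_copy _ _, polyTime_copy _ _, polyTime_copy _ _, hc.rename 0,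
      polyTime_copy _ _, polyTime_prepend _ _, polyTime_copy _ _, polyTime_qappend _ _, by simp⟩
  · exact ⟨polyTime_copy _ _, hl, polyTime_split _ _ _, polyTime_copy _ _, polyTime_copy _ _,
      polyTime_copy _ _, polyTime_copy _ _, polyTime_qappend _ _, hg.rename 0, polyTime_copy _ _,
      polyTime_xor _ _, by simp⟩

variable (A : UE.Adversary) (k : ℕ)

theorem run_pirateDecrypt (hS : S.IsScheme) {r : List Bool} (hr : r.length = S.msgLen k)
    (i z ct : List Bool) (R : List ℕ) :
    (fun m => m.cl (.main 0)) <$> (S.pirateDecrypt A).run (Mem.load [ones k, i, r ++ z, ct] [R]) =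
      xorBits r <$> (fun m => m.cl (.main 0)) <$>
        A.guess.run (Mem.load [ones k, i, z, ct] [R]) := by
  obtain ⟨ml, hml, hlen⟩ := hS.run_lenProg k
  simp [pirateDecrypt, hml, hlen, ← hr]

/-- The memory that the first stage of the pirate leaves, where `m` is left by that of the
cloner. -/
def pirateMem (pk : List Bool) (m : Mem) : Mem :=
  ((((Mem.load [ones k, pk] []).setC (.sub 0 (.main 0)) (ones k)).setC
    (.sub 1 (.main 0)) (ones k)).put 0 m).setC (.main 0) (m.cl (.main 0))

theorem run_pirateQuery (pk : List Bool) : (pirateQuery A).run (Mem.load [ones k, pk] []) =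
    pirateMem k pk <$> A.query.run (Mem.load [ones k] []) := by
  simp [pirateQuery]
  rfl

theorem tossesCoin_pirateClone :
    TossesCoin (.block [.randomBit (.main 2), .push true (.main 3)]) fun m b =>
      (m.setC (.main 2) (b :: m.cl (.main 2))).setC (.main 3) (true :: m.cl (.main 3)) := by
  intro m L hL
  rw [run_block_cons, QComp.bind_apply, tossesCoin_randomBit _ _ _ hL]
  simp [QComp.pure_apply]

theorem foldl_pirateClone (w : List Bool) (m : Mem) :
    w.foldl (fun m b =>
      (m.setC (.main 2) (b :: m.cl (.main 2))).setC (.main 3) (true :: m.cl (.main 3))) m =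
      (m.setC (.main 2) (w.reverse ++ m.cl (.main 2))).setC (.main 3)
        (ones w.length ++ m.cl (.main 3)) := by
  induction w generalizing m with
  | nil => simp [ones, Mem.setC]
  | cons b w ih =>
    rw [List.foldl_cons, ih]
    ext x : 1
    · simp only [Mem.cl_setC]
      split_ifs <;> simp_all [ones, List.replicate_succ']
    · rfl

/-- What the cloner finds in its frame is exactly `cloneInput` for a uniform `r`. The only traces of
the simulation are the prefix `r` of the description and the `ℓ` qubit names spent on coins. -/
theorem expect_pirateClone (hS : S.IsScheme) (pk : List Bool) (m : Mem) {sks : List (List ℕ)}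
    (hq : sks.length = (m.cl (.main 0)).length)
    {H : List Bool → List Bool → List ℕ → Lab → ℝ}
    (hH : ∀ c, 0 ≤ c → ∀ z w l L, H z w l (L.scale c) = c * H z w l L) {L : Lab} (hL : L.WF) :
    expect ((S.pirateClone A).run (((pirateMem k pk m).setC
      (.main 0) (encodeLengths (sks.map List.length))).setQ (.main 0) sks.flatten))
      (fun m' => H (m'.cl (.main 0)) (m'.cl (.main 1)) (m'.qu (.main 0))) L =
    average (S.msgLen k) fun r => expect (A.clone.run (cloneInput m sks r))
      (fun m' => H (r ++ m'.cl (.main 0)) (m'.cl (.main 1)) (m'.qu (.main 0)))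
      (L.bump (S.msgLen k)) := by
  obtain ⟨ml, hml, hlen⟩ := hS.run_lenProg k
  simp [pirateClone, pirateMem, hml, hlen]
  rw [expect_bind, expect_runTimes tossesCoin_pirateClone _ _ _ hL]
  · simp only [foldl_pirateClone]
    rw [← average_reverse]
    refine average_congr fun w hw => ?_
    simp [runTimes_prepend, expect_map]
    congr 2
    simp only [cloneInput, List.map_const', hq, encodeLengths_replicate, Mem.setQ_setQ]
    rfl
  · intro c hc m L
    exact (Homogeneous.run _ _).expect_scale (fun c hc m L => hH c hc _ _ _ L) hc L

/-- The part of the anti-piracy game that follows the output of the decryptors. -/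
def decryptPhase (S : SDE) (B : SDE.Adversary) (q : ℕ) (pk z w : List Bool) (l : List ℕ) :
    QComp Bool := do
  let msg ← QComp.uniformBits (S.msgLen k)
  let ct ← (S.runEnc k pk msg).isolated
  let outs ← (List.range (q + 1)).mapM fun i => do
    let m ← B.decrypt.run (Mem.load [ones k, ones (i + 1), z, ct]
      [(cutInto (decodeLengths w) l).getD i []])
    return m.cl (.main 0)
  return decide (∀ out ∈ outs, out = msg)

/-- The part of the anti-piracy game that follows the generation of the keys. -/
def attackPhase (S : SDE) (B : SDE.Adversary) (keys : List Bool × List Bool) : QComp Bool := do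
  let m ← B.query.run (Mem.load [ones k, keys.1] [])
  let sks ← repeatComp (m.cl (.main 0)).length (S.runKeyGen k keys.2)
  let m' ← B.pirate.run
    ((m.setC (.main 0) (encodeLengths (sks.map List.length))).setQ (.main 0) sks.flatten)
  decryptPhase k S B (m.cl (.main 0)).length keys.1 (m'.cl (.main 0)) (m'.cl (.main 1))
    (m'.qu (.main 0))

theorem antiPiracyGame_eq (S : SDE) (B : SDE.Adversary) :
    S.antiPiracyGame B k = (S.runSetup k).isolated >>= attackPhase k S B := rfl

theorem homogeneous_decryptPhase (S : SDE) (B : SDE.Adversary) (q : ℕ) (pk z w : List Bool)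
    (l : List ℕ) : (decryptPhase k S B q pk z w l).Homogeneous :=
  (Homogeneous.uniformBits _).bind fun _ => (Homogeneous.isolated _).bind fun _ =>
    (Homogeneous.mapM (fun _ => (Homogeneous.run _ _).bind fun _ => Homogeneous.pure _) _).bind
      fun _ => Homogeneous.pure _

theorem homogeneous_attackPhase (S : SDE) (B : SDE.Adversary) (keys : List Bool × List Bool) :
    (attackPhase k S B keys).Homogeneous :=
  (Homogeneous.run _ _).bind fun _ =>
    (Homogeneous.repeatComp (homogeneous_runKeyGen S k keys.2) _).bind fun _ =>
      (Homogeneous.run _ _).bind fun _ => homogeneous_decryptPhase k S B _ _ _ _ _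

/-- All decryptors return `s` exactly if all guesses equal `r ⊕ s`, whatever the lengths of the
guesses. -/
theorem expect_decryptPhase (hS : S.IsScheme) (q : ℕ) (pk : List Bool) {r : List Bool}
    (hr : r.length = S.msgLen k) (z w : List Bool) (l : List ℕ) :
    (decryptPhase k S (S.pirate A) q pk (r ++ z) w l).expect accept = fun L =>
      average (S.msgLen k) fun s => mean (S.runEnc k pk s) fun ct =>
        (guessPhase A k z (cutInto (decodeLengths w) l) q ct (xorBits r s)).expect accept L := by
  have hG (s ct : List Bool) : Homogeneous (do
      let outs ← (List.range (q + 1)).mapM fun i => do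
        let m ← (S.pirate A).decrypt.run (Mem.load [ones k, ones (i + 1), r ++ z, ct]
          [(cutInto (decodeLengths w) l).getD i []])
        return m.cl (.main 0)
      return decide (∀ out ∈ outs, out = s)) :=
    (Homogeneous.mapM (fun _ => (Homogeneous.run _ _).bind fun _ => Homogeneous.pure _) _).bind
      fun _ => Homogeneous.pure _
  funext L
  rw [decryptPhase, expect_bind, expect_uniformBits]
  · refine average_congr fun s hs => ?_
    rw [expect_bind, expect_isolated _ fun c hc ct L => (hG s ct).expect_accept_scale c hc L]
    refine mean_congr fun ct => ?_
    simp only [pirate, bind_pure_comp, run_pirateDecrypt A k hS hr, guessPhase, mapM_map,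
      expect_map, List.forall_mem_map, xorBits_eq_iff (hr.trans hs.symm)]
  · intro c hc s L
    exact ((Homogeneous.isolated _).bind fun ct => hG s ct).expect_accept_scale c hc L

/-- Both games become the same iterated sum over setup, `s`, `ct`, `r` and the branches of the
cloner. They differ in when `s`, `ct` and `r` are drawn, which is immaterial because none of these
draws depends on the quantum state. -/
theorem prob_antiPiracyGame_pirate (hS : S.IsScheme) :
    (S.antiPiracyGame (S.pirate A) k).prob = (S.toUE.searchGame A k).prob := by
  rw [prob_searchGame A k hS, prob_eq_expect, antiPiracyGame_eq, expect_bind,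
    expect_isolated _ fun c hc a L => (homogeneous_attackPhase k S _ a).expect_accept_scale c hc L]
  refine mean_congr fun pm => ?_
  have inner (m : Mem) {L : Lab} (hL : L.WF) (hm : m.WF L.next) :
      expect (repeatComp (m.cl (.main 0)).length (S.runKeyGen k pm.2)) (fun sks =>
        expect ((S.pirateClone A).run (((pirateMem k pm.1 m).setC
          (.main 0) (encodeLengths (sks.map List.length))).setQ (.main 0) sks.flatten))
          fun m' => (decryptPhase k S (S.pirate A) (m.cl (.main 0)).length pm.1 (m'.cl (.main 0))
            (m'.cl (.main 1)) (m'.qu (.main 0))).expect accept) L =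
      average (S.msgLen k) fun s => mean (S.runEnc k pm.1 s) fun ct =>
        average (S.msgLen k) fun r =>
          expect (repeatComp (m.cl (.main 0)).length (S.runKeyGen k pm.2)) (fun sks =>
            expect (clonePhase A k (cloneInput m sks r) (m.cl (.main 0)).length ct (xorBits s r))
              accept) L := by
    trans expect (repeatComp (m.cl (.main 0)).length (S.runKeyGen k pm.2)) (fun sks L =>
      average (S.msgLen k) fun s => mean (S.runEnc k pm.1 s) fun ct => average (S.msgLen k) fun r =>
        expect (clonePhase A k (cloneInput m sks r) (m.cl (.main 0)).length ct (xorBits s r))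
          accept L) L
    swap
    · simp only [expect_average, expect_mean]
    refine expect_congr fun t ht => ?_
    obtain ⟨hlen, hwf, hsks, hnext⟩ :=
      repeatComp_wf (fun L hL => runKeyGen_wf S k pm.2 hL) _ hL t ht
    rw [expect_pirateClone A k hS pm.1 m hlen (H := fun z w l =>
      (decryptPhase k S (S.pirate A) (m.cl (.main 0)).length pm.1 z w l).expect accept)
      (fun c hc _ _ _ L => (homogeneous_decryptPhase k S _ _ _ _ _ _).expect_accept_scale c hc L)
      hwf]
    simp only [mean_average]
    -- The pirate draws `r` before the challenger draws `s`.
    rw [average_comm]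
    refine average_congr fun r hr => ?_
    simp only [expect_decryptPhase A k hS _ _ hr, expect_average, expect_mean]
    refine average_congr fun s hs => mean_congr fun ct => ?_
    -- In the search game no names are spent on the pirate's coins; they can be skipped there as
    -- well.
    rw [← expect_clonePhase_bump A k _ _ _ hwf (cloneInput_wf r (hm.mono hnext) hsks) (S.msgLen k),
      xorBits_comm (hr.trans hs.symm), clonePhase, expect_bind]
  rw [SDE.attackPhase, expect_bind]
  trans expect (A.query.run (Mem.load [ones k] [])) (fun m L =>
    average (S.msgLen k) fun s => mean (S.runEnc k pm.1 s) fun ct => average (S.msgLen k) fun r =>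
      expect (repeatComp (m.cl (.main 0)).length (S.runKeyGen k pm.2)) (fun sks =>
        expect (clonePhase A k (cloneInput m sks r) (m.cl (.main 0)).length ct (xorBits s r))
          accept) L) Lab.vacuum
  swap
  · simp only [expect_average, expect_mean]
  rw [show (S.pirate A).query = pirateQuery A from rfl, run_pirateQuery, expect_map]
  refine expect_congr fun r hr => ?_
  obtain ⟨h₁, h₂, -⟩ := run_wf Lab.WF.vacuum (Mem.WF.load _ _) r hr
  rw [← inner r.1 h₁ h₂]
  simp only [expect_bind]
  rfl

end SDE

/-! # Negligible functions -/

/-- The bound for a single `γ` handles only one power of `k`; to beat `k^d`, a `γ` of order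
`k^{-(d+1)}` is used, with `ν` depending on `d`. -/
theorem negligible_of_le {f : ℕ → ℝ} (hf : ∀ k, 0 ≤ f k)
    (h : ∀ γ, InversePolynomial γ → ∃ ν, Negligible ν ∧ ∀ k, f k ≤ γ k + ν k) :
    Negligible f := by
  intro d
  -- The summand `1` keeps the polynomial positive at `k = 0`.
  obtain ⟨ν, hν, hle⟩ := h (fun k => 1 / ((k : ℝ) ^ (d + 1) + 1))
    ⟨Polynomial.X ^ (d + 1) + 1, fun k => by simp⟩
  have h₁ : Filter.Tendsto (fun k : ℕ => 1 / (k : ℝ) + (k : ℝ) ^ d * ν k) Filter.atTop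
      (nhds 0) := by
    simpa using tendsto_one_div_atTop_nhds_zero_nat.add (hν d)
  refine squeeze_zero'
    (Filter.Eventually.of_forall fun k => mul_nonneg (by positivity) (hf k)) ?_ h₁
  filter_upwards [Filter.eventually_gt_atTop 0] with k hk
  have hk' : (0 : ℝ) < k := by exact_mod_cast hk
  calc (k : ℝ) ^ d * f k ≤ (k : ℝ) ^ d * (1 / ((k : ℝ) ^ (d + 1) + 1) + ν k) := by
        gcongr
        exact hle k
    _ = (k : ℝ) ^ d / ((k : ℝ) ^ (d + 1) + 1) + (k : ℝ) ^ d * ν k := by ring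
    _ ≤ 1 / (k : ℝ) + (k : ℝ) ^ d * ν k := by
        gcongr ?_ + _
        rw [div_le_div_iff₀ (by positivity) hk']
        ring_nf
        linarith

theorem SDE.searchSecure_toUE {S : SDE} (hS : S.IsScheme) (hsec : S.AntiPiracySecure) :
    S.toUE.SearchSecure := by
  intro A hA
  refine ⟨fun k => max 0 ((S.toUE.searchGame A k).prob - 1 / 2 ^ S.msgLen k),
    negligible_of_le (fun k => le_max_left _ _) fun γ hγ => ?_, fun k => ?_⟩
  · obtain ⟨ν, hν, h⟩ := hsec γ hγ (S.pirate A) (SDE.qpt_pirate hS hA)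
    -- The bound must also dominate `0` in the maximum, hence the absolute value.
    refine ⟨fun k => |ν k|, fun n => by simpa [abs_mul] using (hν n).abs, fun k => max_le ?_ ?_⟩
    · obtain ⟨p, hp⟩ := hγ
      have : 0 ≤ γ k := by
        rw [(hp k).2]
        positivity
      positivity
    · have := h k
      rw [SDE.prob_antiPiracyGame_pirate A k hS] at this
      linarith [le_abs_self (ν k)]
  · have := le_max_right 0 ((S.toUE.searchGame A k).prob - 1 / 2 ^ S.msgLen k)
    change _ ≤ 1 / 2 ^ S.msgLen k + _
    linarith

end Unclonable

end


theorem theorem9p3 (S : Unclonable.SDE) (hS : S.IsScheme) (hsec : S.AntiPiracySecure) :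
    S.toUE.IsScheme ∧ S.toUE.SearchSecure := by
  exact ⟨Unclonable.SDE.isScheme_toUE hS, Unclonable.SDE.searchSecure_toUE hS hsec⟩
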